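/- \textbf{Setting.} Let $E$ (states), $A$ and $B$ (actions of players 1 and 2) be Borel spaces, i.e. separable metrizable spaces that are homeomorphic to Borel subsets of Polish spaces. For each $x\in E$ let $A_x\subseteq A$ and $B_x\subseteq B$ be non-empty measurable sets of admissible actions, such that there are measurable maps $s:E\to A$, $t:E\to B$ with $s(x)\in A_x$, $t(x)\in B_x$ for all $x$. Let $Q$ be a probability transition kernel from $E\times A\times B$ to $E$, $r:E\times A\times B\to\mathbb R$ measurable with $0\le r\le\bar r$ for a constant $\bar r$, $\beta\in(0,1]$ and $\bar\gamma>0$. Let $\mathbb P(A)$ be the set of probability measures on $A$ with the weak topology and its Borel $\sigma$-algebra, $\mathbb P(A_x)=\{\mu\in\mathbb P(A):\mu(A_x)=1\}$; similarly for $B$. A (randomized Markov) policy of player 1 is a sequence $\pi=(f_k)_{k\ge 0}$ of measurable maps $f_k:E\to\mathbb P(A)$ with $f_k(x)\in\mathbb P(A_x)$ for all $x$; a policy of player 2 is a sequence $\sigma=(g_k)_{k\ge 0}$ of measurable maps $g_k:E\to\mathbb P(B)$ with $g_k(x)\in\mathbb P(B_x)$. Let $\mathbb P_x^{\pi\sigma}$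 be the law (Ionescu-Tulcea) of the process $(X_k,A_k,B_k)_{k\ge0}$ with $X_0=x$ in which, given the past, $A_k\sim f_k(X_k)$ and $B_k\sim g_k(X_k)$ are chosen independently and then $X_{k+1}\sim Q(\cdot\,|X_k,A_k,B_k)$. For $\gamma\in(0,\bar\gamma]$ and $N\ge 0$ put $$V_{N\pi\sigma}(x,\gamma)=\mathbb E_x^{\pi\sigma}\Big[\exp\Big(\gamma\sum_{k=0}^{N-1}\beta^k r(X_k,A_k,B_k)\Big)\Big],\qquad V_N(x,\gamma)=\inf_\sigma\sup_\pi V_{N\pi\sigma}(x,\gamma);$$ thus $V_0=1$. The $N$-stage game has the value $V_N$ if $V_N(x,\gamma)=\sup_\pi\inf_\sigma V_{N\pi\sigma}(x,\gamma)$ for all $x$ and $\gamma$. For given $\gamma$, a policy $\pi^*$ is optimal for player 1 if $V_{N\pi^*\sigma}(x,\gamma)\ge\sup_\pi\inf_{\sigma'}V_{N\pi\sigma'}(x,\gamma)$ for all $x$ and $\sigma$, and $\sigma^*$ is optimal for player 2 if $V_{N\pi\sigma^*}(x,\gamma)\le\inf_{\sigma}\sup_{\pi'}V_{N\pi'\sigma}(x,\gamma)$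 for all $x$ and $\pi$. For a bounded measurable $v:E\times(0,\bar\gamma]\to\mathbb R$, $\mu\in\mathbb P(A_x)$, $\nu\in\mathbb P(B_x)$ let $$(Lv)(x,\gamma,\mu,\nu)=\int v(x',\beta\gamma)\,\tilde Q(dx'|x,\gamma,\mu,\nu),\qquad \tilde Q(dx'|x,\gamma,\mu,\nu)=\iint e^{\gamma r(x,a,b)}Q(dx'|x,a,b)\,\mu(da)\,\nu(db),$$ $$(Tv)(x,\gamma)=\inf_g\sup_f\,(Lv)(x,\gamma,f(x),g(x)),$$ where $f$ and $g$ run over the measurable maps $E\to\mathbb P(A)$, $E\to\mathbb P(B)$ with $f(x)\in\mathbb P(A_x)$, $g(x)\in\mathbb P(B_x)$ for all $x$. \textbf{Assumptions.} (A1) $A_x$ and $B_x$ are compact for every $x\in E$. (A2) The correspondences $x\mapsto A_x$ and $x\mapsto B_x$ are continuous: $\{x:A_x\cap C\ne\emptyset\}$ is closed for every closed $C\subseteq A$ and $\{x:A_x\cap D\neq\emptyset\}$ is open for every open $D\subseteq A$, and likewise for $B_x$. (A3) $r$ is continuous on $E\times A\times B$. (A4) For every bounded continuous $v:E\to\mathbb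 R$ the map $(x,a,b)\mapsto\int v(x')\,Q(dx'|x,a,b)$ is continuous. \textbf{Theorem.} Assume (A1)--(A4) and let $N\ge0$. (a) For $n=1,\dots,N$ the function $V_n$ is continuous and bounded on $E\times(0,\bar\gamma]$, and for all $(x,\gamma)$ $$V_n(x,\gamma)=(TV_{n-1})(x,\gamma)=\inf_{\nu\in\mathbb P(B_x)}\sup_{\mu\in\mathbb P(A_x)}(LV_{n-1})(x,\gamma,\mu,\nu)=\sup_{\mu\in\mathbb P(A_x)}\inf_{\nu\in\mathbb P(B_x)}(LV_{n-1})(x,\gamma,\mu,\nu).$$ (b) For $n=1,\dots,N$ there are measurable maps $\mu_n^*:E\times(0,\bar\gamma]\to\mathbb P(A)$ and $\nu_n^*:E\times(0,\bar\gamma]\to\mathbb P(B)$ with $\mu_n^*(x,\gamma)\in\mathbb P(A_x)$, $\nu_n^*(x,\gamma)\in\mathbb P(B_x)$ such that for all $(x,\gamma)$ the pair $(\mu_n^*(x,\gamma),\nu_n^*(x,\gamma))$ is a saddle point of $(\mu,\nu)\mapsto(LV_{n-1})(x,\gamma,\mu,\nu)$ on $\mathbb P(A_x)\times\mathbb P(B_x)$,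 that is, $$(LV_{n-1})(x,\gamma,\mu,\nu_n^*(x,\gamma))\le(LV_{n-1})(x,\gamma,\mu_n^*(x,\gamma),\nu_n^*(x,\gamma))\le(LV_{n-1})(x,\gamma,\mu_n^*(x,\gamma),\nu)$$ for all $\mu\in\mathbb P(A_x)$, $\nu\in\mathbb P(B_x)$. The function $V_N$ is the value of the $N$-stage game. For every choice of such maps and every $\gamma\in(0,\bar\gamma]$, the policies given by $f_k^*(x)=\mu_{N-k}^*(x,\gamma\beta^k)$ and $g_k^*(x)=\nu_{N-k}^*(x,\gamma\beta^k)$ for $k=0,\dots,N-1$ are optimal for players 1 and 2, respectively, in the $N$-stage game with parameter $\gamma$ (the decision rules at stages $k\ge N$ are irrelevant). -/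

import Mathlib

open MeasureTheory ProbabilityTheory Topology

noncomputable section

namespace RiskGame

/-- The set `ℙ(S)` of probability measures on `Y` that are concentrated on `S ⊆ Y`. -/
def probOn {Y : Type*} [MeasurableSpace Y] (S : Set Y) : Set (ProbabilityMeasure Y) :=
  {μ | (μ : Measure Y) S = 1}

/-- Measurable maps `f : X → ℙ(Y)` with `f x ∈ ℙ(Φ x)` for all `x`. The σ-algebra on `ℙ(Y)` is the
one generated by the evaluations `μ ↦ μ S`; for a separable metrizable `Y` it is the Borel
σ-algebra of the weak topology. -/
def Rule {X Y : Type*} [MeasurableSpace X] [MeasurableSpace Y] (Φ : X → Set Y) : Type _ :=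
  {f : X → ProbabilityMeasure Y // Measurable f ∧ ∀ x, f x ∈ probOn (Φ x)}

/-- A rule read as a transition probability from `X` to `Y`. -/
def Rule.kernel {X Y : Type*} [MeasurableSpace X] [MeasurableSpace Y] {Φ : X → Set Y}
    (f : Rule Φ) : Kernel X Y where
  toFun x := (f.1 x : Measure Y)
  measurable' := measurable_subtype_coe.comp f.2.1

instance Rule.isMarkovKernel {X Y : Type*} [MeasurableSpace X] [MeasurableSpace Y]
    {Φ : X → Set Y} (f : Rule Φ) : IsMarkovKernel f.kernel :=
  ⟨fun x => inferInstanceAs (IsProbabilityMeasure (f.1 x : Measure Y))⟩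

/-- `(p, q)` is a saddle point of `v : P × R → ℝ`; the first player maximizes. -/
def IsSaddlePoint {P R : Type*} (v : P → R → ℝ) (p : P) (q : R) : Prop :=
  (∀ p', v p' q ≤ v p q) ∧ (∀ q', v p q ≤ v p q')

/-- The data of a two-person zero-sum stochastic game with state space `E` and action spaces `A`
(player 1, maximizing) and `B` (player 2, minimizing), together with the discount factor and the
upper bound of the risk-sensitivity parameter. -/
structure Game (E A B : Type*) [MeasurableSpace E] [MeasurableSpace A] [MeasurableSpace B] where
  /-- admissible actions of player 1 -/
  admA : E → Set A
  /-- admissible actions of player 2 -/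
  admB : E → Set B
  measurableSet_admA : ∀ x, MeasurableSet (admA x)
  measurableSet_admB : ∀ x, MeasurableSet (admB x)
  exists_selector_admA : ∃ s : E → A, Measurable s ∧ ∀ x, s x ∈ admA x
  exists_selector_admB : ∃ s : E → B, Measurable s ∧ ∀ x, s x ∈ admB x
  /-- transition kernel -/
  Q : Kernel (E × A × B) E
  markov : IsMarkovKernel Q
  /-- one-stage reward of player 1 -/
  r : E × A × B → ℝ
  measurable_r : Measurable r
  /-- upper bound of the reward -/
  rbar : ℝ
  r_nonneg : ∀ p, 0 ≤ r p
  r_le : ∀ p, r p ≤ rbar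
  /-- discount factor -/
  β : ℝ
  β_pos : 0 < β
  β_le_one : β ≤ 1
  /-- upper bound of the risk-sensitivity parameter -/
  γbar : ℝ
  γbar_pos : 0 < γbar

namespace Game

variable {E A B : Type*} [MeasurableSpace E] [MeasurableSpace A] [MeasurableSpace B]

instance (G : Game E A B) : IsMarkovKernel G.Q := G.markov

/-- The interval `(0, γbar]` of risk-sensitivity parameters. -/
abbrev Risk (G : Game E A B) : Type := Set.Ioc (0 : ℝ) G.γbar

/-- The parameter `β ^ k * γ`. -/
def rescale (G : Game E A B) (k : ℕ) (γ : G.Risk) : G.Risk :=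
  ⟨G.β ^ k * γ, mul_pos (pow_pos G.β_pos k) γ.2.1,
    (mul_le_of_le_one_left γ.2.1.le (pow_le_one₀ G.β_pos.le G.β_le_one)).trans γ.2.2⟩

/-- Randomized decision rules of player 1 (the set `𝔽`). -/
abbrev RuleA (G : Game E A B) : Type _ := Rule G.admA

/-- Randomized decision rules of player 2 (the set `𝔾`). -/
abbrev RuleB (G : Game E A B) : Type _ := Rule G.admB

/-- Randomized Markov policies of player 1. -/
abbrev PolicyA (G : Game E A B) : Type _ := ℕ → G.RuleA

/-- Randomized Markov policies of player 2. -/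
abbrev PolicyB (G : Game E A B) : Type _ := ℕ → G.RuleB

/-- Admissible measurable maps `E × (0, γbar] → ℙ(A)`. -/
abbrev SelectorA (G : Game E A B) : Type _ := Rule (fun z : E × G.Risk => G.admA z.1)

/-- Admissible measurable maps `E × (0, γbar] → ℙ(B)`. -/
abbrev SelectorB (G : Game E A B) : Type _ := Rule (fun z : E × G.Risk => G.admB z.1)

/-! ### The controlled process and the criterion -/

/-- From the state `x`, the law of `(x, a, b)` with `a ~ f x` and `b ~ g x` independent. -/
def decisionKernel (G : Game E A B) (f : G.RuleA) (g : G.RuleB) : Kernel E (E × A × B) :=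
  Kernel.id ×ₖ (f.kernel ×ₖ g.kernel)

instance (G : Game E A B) (f : G.RuleA) (g : G.RuleB) : IsMarkovKernel (G.decisionKernel f g) := by
  unfold decisionKernel; infer_instance

/-- From `(x, a, b)`, the law of `(x', a', b')` with `x' ~ Q(x, a, b)` and then `a' ~ f x'`,
`b' ~ g x'` independent. -/
def stepKernel (G : Game E A B) (f : G.RuleA) (g : G.RuleB) : Kernel (E × A × B) (E × A × B) :=
  G.decisionKernel f g ∘ₖ G.Q

instance (G : Game E A B) (f : G.RuleA) (g : G.RuleB) : IsMarkovKernel (G.stepKernel f g) := by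
  unfold stepKernel; infer_instance

/-- The conditional law of stage `n + 1` given the history `(x₀, a₀, b₀), …, (xₙ, aₙ, bₙ)`. -/
def historyKernel (G : Game E A B) (π : G.PolicyA) (σ : G.PolicyB) (n : ℕ) :
    Kernel (Finset.Iic n → E × A × B) (E × A × B) :=
  (G.stepKernel (π (n + 1)) (σ (n + 1))).comap (fun h => h ⟨n, Finset.mem_Iic.2 le_rfl⟩)
    (measurable_pi_apply _)

instance (G : Game E A B) (π : G.PolicyA) (σ : G.PolicyB) (n : ℕ) :
    IsMarkovKernel (G.historyKernel π σ n) := by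
  unfold historyKernel; infer_instance

/-- The law, given by the Ionescu-Tulcea theorem, of the process `(Xₖ, Aₖ, Bₖ)` with initial
state `x` under the policies `π` and `σ`. -/
def pathMeasure (G : Game E A B) (π : G.PolicyA) (σ : G.PolicyB) (x : E) :
    Measure (ℕ → E × A × B) :=
  Kernel.trajMeasure (X := fun _ => E × A × B) (G.decisionKernel (π 0) (σ 0) x)
    (G.historyKernel π σ)

/-- The reward `R_N = ∑_{k < N} β ^ k * r(Xₖ, Aₖ, Bₖ)`. -/
def totalReward (G : Game E A B) (N : ℕ) (ω : ℕ → E × A × B) : ℝ :=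
  ∑ k ∈ Finset.range N, G.β ^ k * G.r (ω k)

/-- The criterion `V_{Nπσ}(x, γ) = 𝔼_x^{πσ}[exp(γ R_N)]`. -/
def payoff (G : Game E A B) (N : ℕ) (π : G.PolicyA) (σ : G.PolicyB) (x : E) (γ : G.Risk) : ℝ :=
  ∫ ω, Real.exp (γ * G.totalReward N ω) ∂(G.pathMeasure π σ x)

/-- The upper value `V_N(x, γ)`, as a function on `E × (0, γbar]`. -/
def upperValue (G : Game E A B) (N : ℕ) (z : E × G.Risk) : ℝ :=
  ⨅ σ : G.PolicyB, ⨆ π : G.PolicyA, G.payoff N π σ z.1 z.2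

/-- The lower value. -/
def lowerValue (G : Game E A B) (N : ℕ) (z : E × G.Risk) : ℝ :=
  ⨆ π : G.PolicyA, ⨅ σ : G.PolicyB, G.payoff N π σ z.1 z.2

/-- `π` is optimal for player 1 in the `N`-stage game with parameter `γ`, from every state. -/
def IsOptimalA (G : Game E A B) (N : ℕ) (γ : G.Risk) (π : G.PolicyA) : Prop :=
  ∀ (x : E) (σ : G.PolicyB), G.lowerValue N (x, γ) ≤ G.payoff N π σ x γ

/-- `σ` is optimal for player 2 in the `N`-stage game with parameter `γ`, from every state. -/
def IsOptimalB (G : Game E A B) (N : ℕ) (γ : G.Risk) (σ : G.PolicyB) : Prop :=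
  ∀ (x : E) (π : G.PolicyA), G.payoff N π σ x γ ≤ G.upperValue N (x, γ)

/-! ### The one-stage operators -/

/-- The transition measure `Q̃(dx' | x, γ, a, b) = exp(γ r(x, a, b)) Q(dx' | x, a, b)`. -/
def tildeQ (G : Game E A B) : Kernel (E × G.Risk × A × B) E where
  toFun p := ENNReal.ofReal (Real.exp (p.2.1 * G.r (p.1, p.2.2))) • G.Q (p.1, p.2.2)
  measurable' := by
    refine Measure.measurable_of_measurable_coe _ fun s hs => ?_
    have h : Measurable fun p : E × G.Risk × A × B => (p.1, p.2.2) := by fun_prop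
    have hr := G.measurable_r.comp h
    have hQ := (G.Q.measurable_coe hs).comp h
    have hγ : Measurable fun p : E × G.Risk × A × B => (p.2.1 : ℝ) := by fun_prop
    simp only [Measure.smul_apply, smul_eq_mul]
    exact (Real.measurable_exp.comp (hγ.mul hr)).ennreal_ofReal.mul hQ

/-- The mixture `Q̃(dx' | x, γ, μ, ν) = ∫∫ Q̃(dx' | x, γ, a, b) μ(da) ν(db)`. -/
def tildeQMix (G : Game E A B) (x : E) (γ : G.Risk) (μ : ProbabilityMeasure A)
    (ν : ProbabilityMeasure B) : Measure E :=
  ((μ : Measure A).prod (ν : Measure B)).bind fun p => G.tildeQ (x, γ, p.1, p.2)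

/-- `(L v)(x, γ, μ, ν) = ∫ v(x', β γ) Q̃(dx' | x, γ, μ, ν)`. -/
def L (G : Game E A B) (v : E × G.Risk → ℝ) (x : E) (γ : G.Risk) (μ : ProbabilityMeasure A)
    (ν : ProbabilityMeasure B) : ℝ :=
  ∫ x', v (x', G.rescale 1 γ) ∂(G.tildeQMix x γ μ ν)

/-- `(T_{fg} v)(x, γ) = ∫ v(x', β γ) Q̃(dx' | x, γ, f(x), g(x))`. -/
def Tfg (G : Game E A B) (f : G.RuleA) (g : G.RuleB) (v : E × G.Risk → ℝ) (z : E × G.Risk) : ℝ :=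
  G.L v z.1 z.2 (f.1 z.1) (g.1 z.1)

/-- The Shapley operator `T v = inf_g sup_f T_{fg} v`. -/
def T (G : Game E A B) (v : E × G.Risk → ℝ) (z : E × G.Risk) : ℝ :=
  ⨅ g : G.RuleB, ⨆ f : G.RuleA, G.Tfg f g v z

/-- `(μ, ν)` gives for every `(x, γ)` a saddle point of `(L v)(x, γ, ·, ·)` on
`ℙ(A_x) × ℙ(B_x)`. -/
def IsSaddleSelector (G : Game E A B) (v : E × G.Risk → ℝ) (μ : G.SelectorA)
    (ν : G.SelectorB) : Prop :=
  ∀ z : E × G.Risk,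
    IsSaddlePoint (P := probOn (G.admA z.1)) (R := probOn (G.admB z.1))
      (fun p q => G.L v z.1 z.2 p q) ⟨μ.1 z, μ.2.2 z⟩ ⟨ν.1 z, ν.2.2 z⟩

/-! ### Markov policies built from selectors -/

/-- The policy `f_k(x) = μ_{N - k}(x, β ^ k γ)`; only `k < N` matters for the `N`-stage game. -/
def selectorPolicyA (G : Game E A B) (N : ℕ) (μ : ℕ → G.SelectorA) (γ : G.Risk) : G.PolicyA :=
  fun k => ⟨fun x => (μ (N - k)).1 (x, G.rescale k γ),
    (μ (N - k)).2.1.comp measurable_prodMk_right, fun x => (μ (N - k)).2.2 (x, G.rescale k γ)⟩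

/-- The policy `g_k(x) = ν_{N - k}(x, β ^ k γ)`; only `k < N` matters for the `N`-stage game. -/
def selectorPolicyB (G : Game E A B) (N : ℕ) (ν : ℕ → G.SelectorB) (γ : G.Risk) : G.PolicyB :=
  fun k => ⟨fun x => (ν (N - k)).1 (x, G.rescale k γ),
    (ν (N - k)).2.1.comp measurable_prodMk_right, fun x => (ν (N - k)).2.2 (x, G.rescale k γ)⟩

end Game

/-- A correspondence is continuous if `{x | Φ x ∩ C ≠ ∅}` is closed for every closed `C` (upper
hemicontinuity) and open for every open `C` (lower hemicontinuity). -/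
def ContinuousCorrespondence {X Y : Type*} [TopologicalSpace X] [TopologicalSpace Y]
    (Φ : X → Set Y) : Prop :=
  (∀ C : Set Y, IsClosed C → IsClosed {x | (Φ x ∩ C).Nonempty}) ∧
    ∀ D : Set Y, IsOpen D → IsOpen {x | (Φ x ∩ D).Nonempty}

end RiskGame

end

/-!
The recursion `value 0 = 1`, `value (n + 1) = inf_ν sup_μ L (value n)` solves the game by backward
induction; the work lies in keeping it within the bounded continuous functions and in choosing
optimal mixed actions measurably.

For a bounded continuous `v ≥ 0`, the function `exp (γ r(x, a, b)) ∫ v(x', β γ) Q(dx' | x, a, b)` is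
bounded and continuous in `(x, γ, a, b)` (`exists_stageGame`). That `v` depends on `γ` is harmless,
since products of weakly convergent probability measures converge weakly. So the one-stage problem
is a game on `ℙ(A_x) × ℙ(B_x)` whose payoff depends continuously on the parameter `z = (x, γ)`. For
fixed `z`, Sion's theorem, applied after embedding `ℙ(Y)` into a topological vector space, gives a
saddle point (`exists_saddle_mixedPayoff`). The pairs `(z, c)` for which some `ν` holds the
maximizer down to `c` form a closed set: against a fixed `ν` pure replies suffice, so the condition
on `(z, c, ν)` is closed by lower hemicontinuity of `x ↦ A_x` (`isClosed_forall_mixedPayoff_le`),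
and `x ↦ ℙ(B_x)` is upper hemicontinuous with compact values by Prokhorov's theorem
(`isClosed_exists_mem_probOn`). Hence the value is lower semicontinuous, and exchanging the players
it is upper semicontinuous as well (`continuous_mixedValue`). The same closed set shows that the
optimal mixed actions form a compact-valued upper hemicontinuous correspondence, which has a
measurable selection (`exists_measurable_selection`); so there are measurable saddle points
(`exists_measurable_saddle`).

For Markov policies the criterion is evaluated backward in time, stage by stage
(`ofReal_payoff`). Each stage is an application of `L`, at the parameter `β ^ k γ` reached by then;
replacing one player's rules by saddle selectors bounds each stage by the next member of the
recursion. Therefore the selector policies form a saddle point of the `N`-stage game with payoff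
`value N` (`upperValue_eq_value_and_lowerValue_eq_value`).
-/

noncomputable section

namespace RiskGame

open Filter Set BoundedContinuousFunction

/-! ### Probability measures concentrated on a compact set -/

section ProbOn

variable {Y : Type*} [MeasurableSpace Y]

lemma mem_probOn_iff {S : Set Y} (hS : MeasurableSet S) (μ : ProbabilityMeasure Y) :
    μ ∈ probOn S ↔ ∀ᵐ y ∂(μ : Measure Y), y ∈ S :=
  (mem_ae_iff_prob_eq_one hS).symm

lemma probOn_mono {S T : Set Y} (hST : S ⊆ T) : probOn S ⊆ probOn T := fun μ hμ =>
  le_antisymm prob_le_one (by rw [← show (μ : Measure Y) S = 1 from hμ]; exact measure_mono hST)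

variable [TopologicalSpace Y]

lemma diracProba_mem_probOn [OpensMeasurableSpace Y] {S : Set Y} {y : Y} (hy : y ∈ S) :
    diracProba y ∈ probOn S := by
  simp [probOn, hy]

lemma probOn_nonempty [OpensMeasurableSpace Y] {S : Set Y} (hS : S.Nonempty) :
    (probOn S).Nonempty :=
  hS.elim fun _ hy => ⟨_, diracProba_mem_probOn hy⟩

lemma isCompact_probOn [T2Space Y] [NormalSpace Y] [BorelSpace Y] {K : Set Y}
    (hK : IsCompact K) : IsCompact (probOn K) := by
  have h := isCompact_setOfPred_probabilityMeasure_mass_eq_compl_isCompact_le (E := Y)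
    (u := fun _ => 0) (K := fun _ => K) tendsto_const_nhds (fun _ => hK) (Or.inl inferInstance)
  convert h using 1
  ext μ
  simp only [probOn, nonpos_iff_eq_zero, forall_const, mem_ofPred_eq,
    ProbabilityMeasure.null_iff_toMeasure_null]
  exact (prob_compl_eq_zero_iff hK.measurableSet).symm

/-- Mass on a closed set is upper semicontinuous for the weak topology. -/
lemma isClosed_le_measure [OpensMeasurableSpace Y] [HasOuterApproxClosed Y] {F : Set Y}
    (hF : IsClosed F) (c : ENNReal) :
    IsClosed {μ : ProbabilityMeasure Y | c ≤ (μ : Measure Y) F} := by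
  refine isClosed_iff_clusterPt.2 fun μ hμ => ?_
  have : (𝓝[{μ : ProbabilityMeasure Y | c ≤ (μ : Measure Y) F}] μ).NeBot := hμ
  refine le_trans ?_ (ProbabilityMeasure.limsup_measure_closed_le_of_tendsto
    (tendsto_id.mono_left (nhdsWithin_le_nhds (a := μ)
      (s := {μ : ProbabilityMeasure Y | c ≤ (μ : Measure Y) F}))) hF)
  exact le_limsup_of_frequently_le (Eventually.frequently self_mem_nhdsWithin)

/-- The evaluation σ-algebra on `ℙ(Y)` is contained in the Borel σ-algebra of the weak topology:
a map into `ℙ(Y)` is measurable as soon as preimages of weakly closed sets are measurable. -/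
lemma measurable_of_measurableSet_preimage_closed {Z : Type*} [MeasurableSpace Z] [BorelSpace Y]
    [HasOuterApproxClosed Y] {s : Z → ProbabilityMeasure Y}
    (hs : ∀ C, IsClosed C → MeasurableSet (s ⁻¹' C)) : Measurable s := by
  refine Measurable.subtype_mk (f := fun z => (s z : Measure Y)) ?_
  refine Measurable.measure_of_isPiSystem_of_isProbabilityMeasure
    (S := {F : Set Y | IsClosed F}) ?_ isPiSystem_isClosed fun F hF => ?_
  · rw [BorelSpace.measurable_eq (α := Y), borel_eq_generateFrom_isClosed]
  · exact measurable_of_Ici fun c => hs _ (isClosed_le_measure hF c)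

/-- For a second-countable metrizable `Y`, countably many weakly continuous functions separate the
points of `ℙ(Y)`: integrals of continuous approximations to indicators of the complements of
finite intersections of basic open sets. -/
lemma exists_seq_continuous_separating [TopologicalSpace.MetrizableSpace Y]
    [SecondCountableTopology Y] [BorelSpace Y] :
    ∃ h : ℕ → ProbabilityMeasure Y → ℝ, (∀ n, Continuous (h n)) ∧
      ∀ μ ν, (∀ n, h n μ = h n ν) → μ = ν := by
  let 𝒯 : Set (Set (Set Y)) := {t | t.Finite ∧ t ⊆ TopologicalSpace.countableBasis Y}
  have h𝒯 : 𝒯.Countable :=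
    countable_ofPred_finite_subset (TopologicalSpace.countable_countableBasis Y)
  have hopen : ∀ t : 𝒯, IsOpen (⋂₀ (t : Set (Set Y))) := fun t =>
    t.2.1.isOpen_sInter fun s hs => TopologicalSpace.isOpen_of_mem_countableBasis (t.2.2 hs)
  have : Countable 𝒯 := h𝒯.to_subtype
  have : Nonempty 𝒯 := ⟨⟨∅, finite_empty, empty_subset _⟩⟩
  obtain ⟨e, he⟩ := exists_surjective_nat (𝒯 × ℕ)
  have hcl : ∀ t : 𝒯, IsClosed (⋂₀ (t : Set (Set Y)))ᶜ := fun t => (hopen t).isClosed_compl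
  refine ⟨fun n μ => μ.toFiniteMeasure.testAgainstNN ((hcl (e n).1).apprSeq (e n).2), fun n => ?_,
    fun μ ν hμν => ?_⟩
  · exact NNReal.continuous_coe.comp (ProbabilityMeasure.continuous_testAgainstNN_eval _)
  · have hcompl : ∀ t : 𝒯, (μ : Measure Y) (⋂₀ (t : Set (Set Y)))ᶜ
        = (ν : Measure Y) (⋂₀ (t : Set (Set Y)))ᶜ := by
      intro t
      refine tendsto_nhds_unique (HasOuterApproxClosed.tendsto_lintegral_apprSeq (hcl t) _) ?_
      refine (HasOuterApproxClosed.tendsto_lintegral_apprSeq (hcl t) _).congr fun m => ?_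
      obtain ⟨n, hn⟩ := he (t, m)
      have h1 := hμν n
      simp only [hn, NNReal.coe_inj, FiniteMeasure.testAgainstNN] at h1
      exact ((ENNReal.toNNReal_eq_toNNReal_iff'
        (BoundedContinuousFunction.lintegral_lt_top_of_nnreal (μ : Measure Y) _).ne
        (BoundedContinuousFunction.lintegral_lt_top_of_nnreal (ν : Measure Y) _).ne).1 h1).symm
    refine Subtype.ext ?_
    refine ext_of_generate_finite (μ := (μ : Measure Y)) (ν := (ν : Measure Y))
      (range fun t : 𝒯 => ⋂₀ (t : Set (Set Y))) ?_ ?_ ?_ ?_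
    · rw [BorelSpace.measurable_eq (α := Y),
        (TopologicalSpace.isBasis_countableBasis Y).borel_eq_generateFrom]
      refine le_antisymm (MeasurableSpace.generateFrom_mono ?_) (MeasurableSpace.generateFrom_le ?_)
      · intro U hU
        exact ⟨⟨{U}, finite_singleton _, singleton_subset_iff.2 hU⟩, by simp⟩
      · rintro _ ⟨t, rfl⟩
        exact MeasurableSet.sInter t.2.1.countable
          fun s hs => MeasurableSpace.measurableSet_generateFrom (t.2.2 hs)
    · rintro _ ⟨t, rfl⟩ _ ⟨t', rfl⟩ -
      exact ⟨⟨t ∪ t', t.2.1.union t'.2.1, union_subset t.2.2 t'.2.2⟩, by simp [sInter_union]⟩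
    · rintro _ ⟨t, rfl⟩
      have h := hcompl t
      rw [prob_compl_eq_one_sub (hopen t).measurableSet,
        prob_compl_eq_one_sub (hopen t).measurableSet] at h
      exact (ENNReal.sub_right_inj ENNReal.one_ne_top prob_le_one prob_le_one).1 h
    · simp

end ProbOn

/-! ### Compact-valued correspondences -/

section Correspondence

variable {X Y : Type*} [TopologicalSpace X] [TopologicalSpace Y]

lemma isOpen_subset_of_upperHemicontinuous {Φ : X → Set Y}
    (huhc : ∀ C : Set Y, IsClosed C → IsClosed {x | (Φ x ∩ C).Nonempty}) {U : Set Y}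
    (hU : IsOpen U) : IsOpen {x | Φ x ⊆ U} := by
  have h := (huhc _ hU.isClosed_compl).isOpen_compl
  convert h using 1
  ext x
  simp [← Set.sdiff_eq, Set.sdiff_nonempty]

/-- An upper hemicontinuous compact-valued correspondence maps compact sets to compact sets. -/
lemma isCompact_biUnion_of_upperHemicontinuous {Φ : X → Set Y} (hΦ : ∀ x, IsCompact (Φ x))
    (huhc : ∀ C : Set Y, IsClosed C → IsClosed {x | (Φ x ∩ C).Nonempty}) {K : Set X}
    (hK : IsCompact K) : IsCompact (⋃ x ∈ K, Φ x) := by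
  refine isCompact_of_finite_subcover fun {ι} U hU hsub => ?_
  refine hK.induction_on (p := fun s => ∃ t : Finset ι, ⋃ x ∈ s, Φ x ⊆ ⋃ i ∈ t, U i) ?_ ?_ ?_ ?_
  · exact ⟨∅, by simp⟩
  · rintro s s' hss' ⟨t, ht⟩
    exact ⟨t, (biUnion_subset_biUnion_left hss').trans ht⟩
  · classical
    rintro s s' ⟨t, ht⟩ ⟨t', ht'⟩
    refine ⟨t ∪ t', ?_⟩
    rw [biUnion_union, Finset.set_biUnion_union]
    exact union_subset_union ht ht'
  · intro x hx
    obtain ⟨t, ht⟩ := (hΦ x).elim_finite_subcover U hU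
      ((subset_biUnion_of_mem (u := Φ) hx).trans hsub)
    refine ⟨{x' | Φ x' ⊆ ⋃ i ∈ t, U i}, mem_nhdsWithin_of_mem_nhds
      ((isOpen_subset_of_upperHemicontinuous huhc
        (isOpen_biUnion fun i _ => hU i)).mem_nhds ht), t, ?_⟩
    exact iUnion₂_subset fun x' hx' => hx'

variable [TopologicalSpace.MetrizableSpace X] [TopologicalSpace.MetrizableSpace Y]
  [SecondCountableTopology Y] [MeasurableSpace Y] [BorelSpace Y]

/-- Passing from a compact-valued correspondence `Φ` to `x ↦ ℙ(Φ x)` preserves upper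
hemicontinuity; the closed set may depend on `x`. Along a convergent sequence the values of `Φ` lie
in one compact set, so Prokhorov's theorem gives a limit measure, and the portmanteau theorem
locates it on the limiting value of `Φ`. -/
theorem isClosed_exists_mem_probOn {Φ : X → Set Y} (hΦ : ∀ x, IsCompact (Φ x))
    (huhc : ∀ C : Set Y, IsClosed C → IsClosed {x | (Φ x ∩ C).Nonempty})
    {F : Set (X × ProbabilityMeasure Y)} (hF : IsClosed F) :
    IsClosed {x | ∃ μ ∈ probOn (Φ x), (x, μ) ∈ F} := by
  let : MetricSpace X := TopologicalSpace.metrizableSpaceMetric X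
  let : MetricSpace Y := TopologicalSpace.metrizableSpaceMetric Y
  refine IsSeqClosed.isClosed fun x x₀ hx hlim => ?_
  choose μ hμ hμF using hx
  have hK := isCompact_biUnion_of_upperHemicontinuous hΦ huhc hlim.isCompact_insert_range
  have hμK : ∀ n, μ n ∈ probOn (⋃ y ∈ insert x₀ (range x), Φ y) := fun n =>
    probOn_mono (subset_biUnion_of_mem (u := Φ) (mem_insert_of_mem _ (mem_range_self n))) (hμ n)
  obtain ⟨μ₀, -, φ, hφ, hμlim⟩ := (isCompact_probOn hK).isSeqCompact hμK
  have hxlim := hlim.comp hφ.tendsto_atTop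
  -- The compact set in `hμK` only yields the limit `μ₀`; that `μ₀` lives on `Φ x₀` is read off the
  -- closed neighbourhoods of `Φ x₀`.
  refine ⟨μ₀, ?_, hF.mem_of_tendsto (hxlim.prodMk_nhds hμlim)
    (Eventually.of_forall fun n => hμF (φ n))⟩
  have hthick : ∀ δ : ℝ, 0 < δ → ∀ᵐ y ∂(μ₀ : Measure Y), y ∈ Metric.cthickening δ (Φ x₀) := by
    intro δ hδ
    have hev : ∀ᶠ n in atTop, Φ (x (φ n)) ⊆ Metric.thickening δ (Φ x₀) :=
      hxlim.eventually ((isOpen_subset_of_upperHemicontinuous huhc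
        Metric.isOpen_thickening).mem_nhds (Metric.self_subset_thickening hδ _))
    have hcl : IsClosed (Metric.cthickening δ (Φ x₀)) := Metric.isClosed_cthickening
    rw [← mem_probOn_iff hcl.measurableSet]
    refine le_antisymm prob_le_one ?_
    refine (isClosed_le_measure hcl 1).mem_of_tendsto hμlim (hev.mono fun n hn => ?_)
    exact (probOn_mono (hn.trans (Metric.thickening_subset_cthickening _ _)) (hμ (φ n))).ge
  rw [mem_probOn_iff (hΦ x₀).measurableSet]
  have hall : ∀ᵐ y ∂(μ₀ : Measure Y), ∀ n : ℕ, y ∈ Metric.cthickening (1 / ((n : ℝ) + 1)) (Φ x₀) :=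
    ae_all_iff.2 fun n => hthick _ Nat.one_div_pos_of_nat
  filter_upwards [hall] with y hy
  rw [← (hΦ x₀).isClosed.closure_eq, Metric.mem_closure_iff_infEDist_zero]
  refine le_antisymm (ENNReal.le_of_forall_pos_le_add fun ε hε _ => ?_) zero_le
  obtain ⟨n, hn⟩ := exists_nat_one_div_lt (show (0 : ℝ) < ε from hε)
  have := Metric.mem_cthickening_iff.1 (hy n)
  rw [zero_add]
  exact this.trans (ENNReal.ofReal_le_of_le_toReal (by simpa using hn.le))

end Correspondence

/-! ### Measurable selection -/

/-- A compact-valued correspondence that hits every closed set on a measurable set of parameters has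
a selection with measurable preimages of closed sets. The selection minimizes a separating sequence
`h 0, h 1, …` of continuous functions lexicographically; each minimization step keeps the values
compact and the hitting sets measurable, and in the limit one point is left. -/
theorem exists_measurable_selection {Z Y : Type*} [MeasurableSpace Z] [TopologicalSpace Y]
    [T2Space Y] (h : ℕ → Y → ℝ) (hcont : ∀ n, Continuous (h n))
    (hsep : ∀ y y', (∀ n, h n y = h n y') → y = y') (Ψ : Z → Set Y)
    (hcomp : ∀ z, IsCompact (Ψ z)) (hne : ∀ z, (Ψ z).Nonempty)
    (hmeas : ∀ C, IsClosed C → MeasurableSet {z | (Ψ z ∩ C).Nonempty}) :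
    ∃ s : Z → Y, (∀ z, s z ∈ Ψ z) ∧ ∀ C, IsClosed C → MeasurableSet (s ⁻¹' C) := by
  let R : ℕ → Z → Set Y := fun n => Nat.rec Ψ (fun n P z => {y ∈ P z | IsMinOn (h n) (P z) y}) n
  have hRsucc : ∀ n z, R (n + 1) z = {y ∈ R n z | IsMinOn (h n) (R n z) y} := fun _ _ => rfl
  have hR : ∀ n, (∀ z, IsCompact (R n z)) ∧ (∀ z, (R n z).Nonempty) ∧
      ∀ C, IsClosed C → MeasurableSet {z | (R n z ∩ C).Nonempty} := by
    intro n
    induction n with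
    | zero => exact ⟨hcomp, hne, hmeas⟩
    | succ n ih =>
      obtain ⟨ihc, ihn, ihm⟩ := ih
      have hmin : ∀ z, ∃ y ∈ R n z, IsMinOn (h n) (R n z) y := fun z =>
        (ihc z).exists_isMinOn (ihn z) (hcont n).continuousOn
      refine ⟨fun z => ?_, fun z => ?_, fun C hC => ?_⟩
      · obtain ⟨y, hy, hymin⟩ := hmin z
        have : R (n + 1) z = R n z ∩ {y' | h n y' ≤ h n y} := by
          rw [hRsucc]
          ext y'
          refine ⟨fun h' => ⟨h'.1, h'.2 hy⟩, fun h' => ⟨h'.1, fun w hw => ?_⟩⟩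
          exact (show h n y' ≤ h n y from h'.2).trans (hymin hw)
        rw [this]
        exact (ihc z).inter_right (isClosed_le (hcont n) continuous_const)
      · exact hmin z
      · -- The minimum over `R n z` is attained in `C` iff every rational level reached on `R n z`
        -- is reached on `R n z ∩ C`.
        have : {z | (R (n + 1) z ∩ C).Nonempty} = {z | (R n z ∩ C).Nonempty} ∩
            ⋂ q : ℚ, ({z | (R n z ∩ {y | h n y ≤ q}).Nonempty}ᶜ ∪
              {z | (R n z ∩ (C ∩ {y | h n y ≤ q})).Nonempty}) := by
          ext z
          simp only [mem_inter_iff, mem_ofPred_eq, mem_iInter, mem_union, mem_compl_iff]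
          constructor
          · rintro ⟨y, hy, hyC⟩
            refine ⟨⟨y, hy.1, hyC⟩, fun q => ?_⟩
            by_cases hq : (R n z ∩ {y | h n y ≤ q}).Nonempty
            · obtain ⟨w, hw, hwq⟩ := hq
              exact Or.inr ⟨y, hy.1, hyC,
                show h n y ≤ q from le_trans (hy.2 hw : h n y ≤ h n w) hwq⟩
            · exact Or.inl hq
          · rintro ⟨hzC, hz⟩
            obtain ⟨y, hy, hymin⟩ :=
              ((ihc z).inter_right hC).exists_isMinOn hzC (hcont n).continuousOn
            refine ⟨y, ⟨hy.1, fun w hw => ?_⟩, hy.2⟩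
            change h n y ≤ h n w
            refine le_of_forall_gt_imp_ge_of_dense fun r hr => ?_
            obtain ⟨q, hq1, hq2⟩ := exists_rat_btwn (show h n w < r from hr)
            rcases hz q with hzq | ⟨v, hv, hvC, hvq⟩
            · exact absurd ⟨w, hw, hq1.le⟩ hzq
            · exact le_trans (hymin ⟨hv, hvC⟩ : h n y ≤ h n v)
                (le_trans (show h n v ≤ q from hvq) hq2.le)
        rw [this]
        refine (ihm C hC).inter (MeasurableSet.iInter fun q => ?_)
        have hq : IsClosed {y | h n y ≤ (q : ℝ)} := isClosed_le (hcont n) continuous_const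
        exact (ihm _ hq).compl.union (ihm _ (hC.inter hq))
  have hanti : ∀ n z, R (n + 1) z ⊆ R n z := fun n z y hy => hy.1
  have hinter : ∀ z C, IsClosed C → (∀ n, (R n z ∩ C).Nonempty) →
      (⋂ n, R n z ∩ C).Nonempty := fun z C hC hn =>
    IsCompact.nonempty_iInter_of_sequence_nonempty_isCompact_isClosed _
      (fun n => inter_subset_inter_left _ (hanti n z)) hn (((hR 0).1 z).inter_right hC)
      fun n => ((hR n).1 z).isClosed.inter hC
  have hex : ∀ z, ∃ y, ∀ n, y ∈ R n z := by
    intro z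
    obtain ⟨y, hy⟩ := hinter z univ isClosed_univ fun n => by simpa using (hR n).2.1 z
    exact ⟨y, fun n => ((mem_iInter.1 hy) n).1⟩
  choose s hs using hex
  have huniq : ∀ z y, (∀ n, y ∈ R n z) → y = s z := fun z y hy =>
    hsep _ _ fun n => le_antisymm ((hy (n + 1)).2 (hs z n)) ((hs z (n + 1)).2 (hy n))
  refine ⟨s, fun z => hs z 0, fun C hC => ?_⟩
  have : s ⁻¹' C = ⋂ n, {z | (R n z ∩ C).Nonempty} := by
    ext z
    simp only [mem_preimage, mem_iInter, mem_ofPred_eq]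
    refine ⟨fun hz n => ⟨s z, hs z n, hz⟩, fun hz => ?_⟩
    obtain ⟨y, hy⟩ := hinter z C hC hz
    rw [mem_iInter] at hy
    rw [← huniq z y fun n => (hy n).1]
    exact (hy 0).2
  rw [this]
  exact MeasurableSet.iInter fun n => (hR n).2.2 C hC

/-! ### Saddle points of bounded functions -/

section SaddlePoint

variable {P R : Type*} {v : P → R → ℝ} {C : ℝ}

lemma bddAbove_range_of_abs_le {ι : Sort*} {f : ι → ℝ} (hf : ∀ i, |f i| ≤ C) :
    BddAbove (range f) :=
  ⟨C, by rintro _ ⟨i, rfl⟩; exact (abs_le.1 (hf i)).2⟩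

lemma bddBelow_range_of_abs_le {ι : Sort*} {f : ι → ℝ} (hf : ∀ i, |f i| ≤ C) :
    BddBelow (range f) :=
  ⟨-C, by rintro _ ⟨i, rfl⟩; exact (abs_le.1 (hf i)).1⟩

lemma abs_iSup_le_of_abs_le {ι : Sort*} [Nonempty ι] {f : ι → ℝ} (hf : ∀ i, |f i| ≤ C) :
    |⨆ i, f i| ≤ C := by
  obtain ⟨i⟩ := ‹Nonempty ι›
  exact abs_le.2 ⟨(abs_le.1 (hf i)).1.trans (le_ciSup (bddAbove_range_of_abs_le hf) i),
    have : Nonempty ι := ⟨i⟩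
    ciSup_le fun j => (abs_le.1 (hf j)).2⟩

lemma abs_iInf_le_of_abs_le {ι : Sort*} [Nonempty ι] {f : ι → ℝ} (hf : ∀ i, |f i| ≤ C) :
    |⨅ i, f i| ≤ C := by
  obtain ⟨i⟩ := ‹Nonempty ι›
  exact abs_le.2 ⟨have : Nonempty ι := ⟨i⟩
    le_ciInf fun j => (abs_le.1 (hf j)).1,
    (ciInf_le (bddBelow_range_of_abs_le hf) i).trans (abs_le.1 (hf i)).2⟩

lemma iSup_iInf_le_iInf_iSup_of_abs_le [Nonempty P] [Nonempty R] (hv : ∀ p q, |v p q| ≤ C) :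
    ⨆ p, ⨅ q, v p q ≤ ⨅ q, ⨆ p, v p q :=
  ciSup_le fun p => le_ciInf fun q =>
    (ciInf_le (bddBelow_range_of_abs_le (hv p)) q).trans
      (le_ciSup (f := fun p => v p q) (bddAbove_range_of_abs_le fun p => hv p q) p)

lemma iInf_iSup_le_of_forall_le [Nonempty P] (hv : ∀ p q, |v p q| ≤ C) {q : R} {c : ℝ}
    (h : ∀ p, v p q ≤ c) : ⨅ q, ⨆ p, v p q ≤ c :=
  (ciInf_le (bddBelow_range_of_abs_le fun q => abs_iSup_le_of_abs_le fun p => hv p q) q).trans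
    (ciSup_le h)

lemma le_iSup_iInf_of_forall_le [Nonempty R] (hv : ∀ p q, |v p q| ≤ C) {p : P} {c : ℝ}
    (h : ∀ q, c ≤ v p q) : c ≤ ⨆ p, ⨅ q, v p q :=
  (le_ciInf h).trans
    (le_ciSup (f := fun p => ⨅ q, v p q)
      (bddAbove_range_of_abs_le fun p => abs_iInf_le_of_abs_le (hv p)) p)

lemma IsSaddlePoint.iInf_iSup_eq {p : P} {q : R} (h : IsSaddlePoint v p q)
    (hv : ∀ p q, |v p q| ≤ C) : ⨅ q, ⨆ p, v p q = v p q := by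
  have : Nonempty P := ⟨p⟩
  have : Nonempty R := ⟨q⟩
  exact le_antisymm (iInf_iSup_le_of_forall_le hv h.1)
    ((le_iSup_iInf_of_forall_le hv h.2).trans (iSup_iInf_le_iInf_iSup_of_abs_le hv))

lemma IsSaddlePoint.iSup_iInf_eq {p : P} {q : R} (h : IsSaddlePoint v p q)
    (hv : ∀ p q, |v p q| ≤ C) : ⨆ p, ⨅ q, v p q = v p q := by
  have : Nonempty P := ⟨p⟩
  have : Nonempty R := ⟨q⟩
  exact le_antisymm ((iSup_iInf_le_iInf_iSup_of_abs_le hv).trans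
    (iInf_iSup_le_of_forall_le hv h.1)) (le_iSup_iInf_of_forall_le hv h.2)

end SaddlePoint

/-! ### The minimax theorem for mixed strategies -/

section Minimax

/-- A probability measure read as the family of its integrals of bounded continuous functions.
This places `ℙ(Y)` in a topological vector space, where convexity makes sense. -/
def integralFamily {Y : Type*} [MeasurableSpace Y] [TopologicalSpace Y]
    (μ : ProbabilityMeasure Y) : (Y →ᵇ ℝ) → ℝ :=
  fun f => ∫ y, f y ∂(μ : Measure Y)

variable {Y : Type*} [MeasurableSpace Y] [TopologicalSpace Y] [TopologicalSpace.MetrizableSpace Y]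
  [BorelSpace Y]

lemma isEmbedding_integralFamily : IsEmbedding (integralFamily (Y := Y)) := by
  have hind : IsInducing (integralFamily (Y := Y)) := by
    refine isInducing_iff_nhds.2 fun μ => le_antisymm ?_ ?_
    · have h : Continuous (integralFamily (Y := Y)) := continuous_pi fun f =>
        ProbabilityMeasure.continuous_integral_boundedContinuousFunction f
      exact (h.tendsto μ).le_comap
    · refine tendsto_id'.1 (ProbabilityMeasure.tendsto_iff_forall_integral_tendsto.2 fun f => ?_)
      exact ((continuous_apply f).tendsto (integralFamily μ)).comp tendsto_comap
  exact ⟨hind, hind.injective⟩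

omit [TopologicalSpace.MetrizableSpace Y] in
lemma convex_image_integralFamily (S : Set Y) :
    Convex ℝ (integralFamily '' probOn S) := by
  rintro _ ⟨μ, hμ, rfl⟩ _ ⟨ν, hν, rfl⟩ a b ha hb hab
  have hsum : ENNReal.ofReal a + ENNReal.ofReal b = 1 := by
    rw [← ENNReal.ofReal_add ha hb, hab, ENNReal.ofReal_one]
  refine ⟨⟨ENNReal.ofReal a • (μ : Measure Y) + ENNReal.ofReal b • (ν : Measure Y), ⟨?_⟩⟩, ?_, ?_⟩
  · simpa using hsum
  · have h1 : (μ : Measure Y) S = 1 := hμ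
    have h2 : (ν : Measure Y) S = 1 := hν
    change (ENNReal.ofReal a • (μ : Measure Y) + ENNReal.ofReal b • (ν : Measure Y)) S = 1
    simpa [h1, h2] using hsum
  · ext f
    have hf : ∀ ρ : ProbabilityMeasure Y, Integrable f (ρ : Measure Y) := fun ρ => f.integrable _
    simp only [integralFamily, ProbabilityMeasure.coe_mk, Pi.add_apply, Pi.smul_apply, smul_eq_mul]
    rw [integral_add_measure ((hf μ).smul_measure ENNReal.ofReal_ne_top)
      ((hf ν).smul_measure ENNReal.ofReal_ne_top), integral_smul_measure, integral_smul_measure,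
      ENNReal.toReal_ofReal ha, ENNReal.toReal_ofReal hb]
    rfl

lemma continuousOn_invFun_integralFamily [Nonempty (ProbabilityMeasure Y)] :
    ContinuousOn (Function.invFun (integralFamily (Y := Y))) (range integralFamily) := by
  rintro _ ⟨μ, rfl⟩
  have hinv := Function.leftInverse_invFun (isEmbedding_integralFamily (Y := Y)).injective
  rw [ContinuousWithinAt, ← isEmbedding_integralFamily.map_nhds_eq, hinv μ, tendsto_map'_iff,
    hinv.comp_eq_id]
  exact tendsto_id

/-- The expectation of `u` under independent `μ` and `ν`. -/
def mixedPayoff {A B : Type*} [MeasurableSpace A] [MeasurableSpace B] (u : A × B → ℝ)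
    (μ : ProbabilityMeasure A) (ν : ProbabilityMeasure B) : ℝ :=
  ∫ p, u p ∂(μ : Measure A).prod (ν : Measure B)

lemma abs_mixedPayoff_le {A B : Type*} [MeasurableSpace A] [MeasurableSpace B] {u : A × B → ℝ}
    {C : ℝ} (hu : ∀ p, |u p| ≤ C) (μ : ProbabilityMeasure A) (ν : ProbabilityMeasure B) :
    |mixedPayoff u μ ν| ≤ C := by
  have := norm_integral_le_of_norm_le_const (μ := (μ : Measure A).prod (ν : Measure B)) (f := u)
    (Eventually.of_forall fun p => by simpa using hu p)
  simpa [mixedPayoff] using this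

lemma mixedPayoff_swap {A B : Type*} [MeasurableSpace A] [MeasurableSpace B] (u : A × B → ℝ)
    (μ : ProbabilityMeasure A) (ν : ProbabilityMeasure B) :
    mixedPayoff (fun p => u p.swap) ν μ = mixedPayoff u μ ν :=
  integral_prod_swap (μ := (μ : Measure A)) (ν := (ν : Measure B)) u

variable {A B : Type*}
  [TopologicalSpace A] [TopologicalSpace.MetrizableSpace A] [SecondCountableTopology A]
  [MeasurableSpace A] [BorelSpace A]
  [TopologicalSpace B] [TopologicalSpace.MetrizableSpace B] [SecondCountableTopology B]
  [MeasurableSpace B] [BorelSpace B]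

lemma continuous_mixedPayoff (u : A × B →ᵇ ℝ) :
    Continuous fun q : ProbabilityMeasure A × ProbabilityMeasure B => mixedPayoff u q.1 q.2 :=
  (ProbabilityMeasure.continuous_integral_boundedContinuousFunction u).comp
    ProbabilityMeasure.continuous_prod

omit [TopologicalSpace.MetrizableSpace B] in
lemma mixedPayoff_eq_integral_left (u : A × B →ᵇ ℝ) (μ : ProbabilityMeasure A)
    (ν : ProbabilityMeasure B) :
    mixedPayoff u μ ν = ∫ a, mixedPayoff u (diracProba a) ν ∂(μ : Measure A) := by
  rw [mixedPayoff, integral_prod _ (u.integrable _)]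
  refine integral_congr_ae (Eventually.of_forall fun a => ?_)
  change _ = ∫ p, u p ∂(Measure.dirac a).prod (ν : Measure B)
  rw [integral_prod _ (u.integrable _), integral_dirac]

/-- In its first argument, the mixed payoff is the integral of a bounded continuous function. -/
lemma exists_mixedPayoff_eq_integralFamily (u : A × B →ᵇ ℝ) (ν : ProbabilityMeasure B) :
    ∃ w : A →ᵇ ℝ, ∀ μ : ProbabilityMeasure A, mixedPayoff u μ ν = integralFamily μ w :=
  ⟨BoundedContinuousFunction.ofNormedAddCommGroup (fun a => mixedPayoff u (diracProba a) ν)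
    ((continuous_mixedPayoff u).comp (continuous_diracProba.prodMk continuous_const)) ‖u‖
    fun _ => abs_mixedPayoff_le u.norm_coe_le_norm _ _,
    fun μ => mixedPayoff_eq_integral_left u μ ν⟩

/-- The minimax theorem for mixed strategies on compact sets of actions. -/
theorem exists_saddle_mixedPayoff (u : A × B →ᵇ ℝ) {S : Set A} {T : Set B} (hS : IsCompact S)
    (hT : IsCompact T) (hSne : S.Nonempty) (hTne : T.Nonempty) :
    ∃ μ ∈ probOn S, ∃ ν ∈ probOn T, ∀ μ' ∈ probOn S, ∀ ν' ∈ probOn T,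
      mixedPayoff u μ' ν ≤ mixedPayoff u μ ν' := by
  have : Nonempty (ProbabilityMeasure A) := (probOn_nonempty hSne).to_type
  have : Nonempty (ProbabilityMeasure B) := (probOn_nonempty hTne).to_type
  have hA := Function.leftInverse_invFun (isEmbedding_integralFamily (Y := A)).injective
  have hB := Function.leftInverse_invFun (isEmbedding_integralFamily (Y := B)).injective
  -- Only the values of `f` on the ranges of the embeddings matter.
  let f : ((B →ᵇ ℝ) → ℝ) → ((A →ᵇ ℝ) → ℝ) → ℝ := fun y x =>
    mixedPayoff u (Function.invFun integralFamily x) (Function.invFun integralFamily y)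
  have hf : ∀ μ ν, f (integralFamily ν) (integralFamily μ) = mixedPayoff u μ ν := fun μ ν => by
    simp only [f, hA μ, hB ν]
  let uswap : B × A →ᵇ ℝ := u.compContinuous ⟨Prod.swap, continuous_swap⟩
  have hcA : Convex ℝ (integralFamily '' probOn S) := convex_image_integralFamily S
  have hcB : Convex ℝ (integralFamily '' probOn T) := convex_image_integralFamily T
  have hcont : ContinuousOn (fun q : ((B →ᵇ ℝ) → ℝ) × ((A →ᵇ ℝ) → ℝ) => f q.1 q.2)
      (range integralFamily ×ˢ range integralFamily) :=
    (continuous_mixedPayoff u).comp_continuousOn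
      ((continuousOn_invFun_integralFamily.comp continuousOn_snd fun q hq => hq.2).prodMk
        (continuousOn_invFun_integralFamily.comp continuousOn_fst fun q hq => hq.1))
  have hlsc : ∀ x ∈ integralFamily '' probOn S,
      LowerSemicontinuousOn (fun y => f y x) (integralFamily '' probOn T) := by
    rintro _ ⟨μ, hμ, rfl⟩
    refine ContinuousOn.lowerSemicontinuousOn ?_
    exact hcont.comp (continuousOn_id.prodMk continuousOn_const)
      fun y hy => ⟨image_subset_range _ _ hy, mem_range_self _⟩
  have hconv : ∀ x ∈ integralFamily '' probOn S,
      QuasiconvexOn ℝ (integralFamily '' probOn T) fun y => f y x := by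
    rintro _ ⟨μ, hμ, rfl⟩
    refine ConvexOn.quasiconvexOn ⟨hcB, ?_⟩
    rintro _ ⟨ν₁, hν₁, rfl⟩ _ ⟨ν₂, hν₂, rfl⟩ a b ha hb hab
    obtain ⟨ν, hν, hνeq⟩ := hcB ⟨ν₁, hν₁, rfl⟩ ⟨ν₂, hν₂, rfl⟩ ha hb hab
    obtain ⟨w, hw⟩ := exists_mixedPayoff_eq_integralFamily uswap μ
    have hw' : ∀ ν, mixedPayoff u μ ν = integralFamily ν w := fun ν =>
      (mixedPayoff_swap u μ ν).symm.trans (hw ν)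
    simp only [← hνeq, hf, hw']
    simp [hνeq]
  have husc : ∀ y ∈ integralFamily '' probOn T,
      UpperSemicontinuousOn (fun x => f y x) (integralFamily '' probOn S) := by
    rintro _ ⟨ν, hν, rfl⟩
    refine ContinuousOn.upperSemicontinuousOn ?_
    exact hcont.comp (continuousOn_const.prodMk continuousOn_id)
      fun y hy => ⟨mem_range_self _, image_subset_range _ _ hy⟩
  have hconc : ∀ y ∈ integralFamily '' probOn T,
      QuasiconcaveOn ℝ (integralFamily '' probOn S) fun x => f y x := by
    rintro _ ⟨ν, hν, rfl⟩
    refine ConcaveOn.quasiconcaveOn ⟨hcA, ?_⟩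
    rintro _ ⟨μ₁, hμ₁, rfl⟩ _ ⟨μ₂, hμ₂, rfl⟩ a b ha hb hab
    obtain ⟨μ, hμ, hμeq⟩ := hcA ⟨μ₁, hμ₁, rfl⟩ ⟨μ₂, hμ₂, rfl⟩ ha hb hab
    obtain ⟨w, hw⟩ := exists_mixedPayoff_eq_integralFamily u ν
    simp only [← hμeq, hf, hw]
    simp [hμeq]
  obtain ⟨_, ⟨ν, hν, rfl⟩, _, ⟨μ, hμ, rfl⟩, h⟩ := Sion.exists_isSaddlePointOn
    ((probOn_nonempty hTne).image _) hcB
    ((isCompact_probOn hT).image isEmbedding_integralFamily.continuous) hlsc hconv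
    hcA ((probOn_nonempty hSne).image _)
    ((isCompact_probOn hS).image isEmbedding_integralFamily.continuous) husc hconc
  refine ⟨μ, hμ, ν, hν, fun μ' hμ' ν' hν' => ?_⟩
  rw [← hf, ← hf]
  exact h _ ⟨ν', hν', rfl⟩ _ ⟨μ', hμ', rfl⟩

end Minimax

/-! ### Games that depend continuously on a parameter -/

section Slice

variable {Z A B : Type*} [TopologicalSpace Z] [TopologicalSpace A] [MeasurableSpace A]
  [TopologicalSpace B] [MeasurableSpace B]

/-- The payoff function at the parameter `z`. -/
def slice (u : Z × A × B →ᵇ ℝ) (z : Z) : A × B →ᵇ ℝ :=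
  u.compContinuous ⟨fun p => (z, p), by fun_prop⟩

/-- The same game with the roles of the players exchanged. -/
def swapGame (u : Z × A × B →ᵇ ℝ) : Z × B × A →ᵇ ℝ :=
  -u.compContinuous ⟨fun p => (p.1, p.2.swap), by fun_prop⟩

lemma mixedPayoff_swapGame (u : Z × A × B →ᵇ ℝ) (z : Z) (μ : ProbabilityMeasure A)
    (ν : ProbabilityMeasure B) :
    mixedPayoff (slice (swapGame u) z) ν μ = -mixedPayoff (slice u z) μ ν := by
  rw [← mixedPayoff_swap (slice u z), mixedPayoff, mixedPayoff, ← integral_neg]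
  rfl

lemma abs_mixedPayoff_slice_le (u : Z × A × B →ᵇ ℝ) (z : Z) (μ : ProbabilityMeasure A)
    (ν : ProbabilityMeasure B) :
    |mixedPayoff (slice u z) μ ν| ≤ ‖u‖ :=
  abs_mixedPayoff_le (fun p => u.norm_coe_le_norm (z, p)) μ ν

/-- The upper value of the game with parameter `z`. -/
def mixedValue (u : Z × A × B →ᵇ ℝ) (Φ : Z → Set A) (Ψ : Z → Set B) (z : Z) : ℝ :=
  ⨅ ν : probOn (Ψ z), ⨆ μ : probOn (Φ z), mixedPayoff (slice u z) μ ν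

end Slice

section Parametric

variable {Z A B : Type*}
  [TopologicalSpace Z]
  [TopologicalSpace A] [TopologicalSpace.MetrizableSpace A] [SecondCountableTopology A]
  [MeasurableSpace A] [BorelSpace A]
  [TopologicalSpace B] [TopologicalSpace.MetrizableSpace B] [SecondCountableTopology B]
  [MeasurableSpace B] [BorelSpace B]

/-- Pure replies suffice against a fixed mixed action. -/
lemma mixedPayoff_le_iff_forall_dirac (u : A × B →ᵇ ℝ) {S : Set A} (hS : MeasurableSet S)
    (ν : ProbabilityMeasure B) (c : ℝ) :
    (∀ μ ∈ probOn S, mixedPayoff u μ ν ≤ c) ↔ ∀ a ∈ S, mixedPayoff u (diracProba a) ν ≤ c := by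
  refine ⟨fun h a ha => h _ (diracProba_mem_probOn ha), fun h μ hμ => ?_⟩
  obtain ⟨w, hw⟩ := exists_mixedPayoff_eq_integralFamily u ν
  have hwa : ∀ a, mixedPayoff u (diracProba a) ν = w a := fun a =>
    (hw _).trans (integral_dirac (f := w) a)
  rw [hw, integralFamily]
  have : ∫ a, w a ∂(μ : Measure A) ≤ ∫ _, c ∂(μ : Measure A) := by
    refine integral_mono_ae (w.integrable _) (integrable_const c) ?_
    filter_upwards [(mem_probOn_iff hS μ).1 hμ] with a ha
    exact (hwa a).symm.trans_le (h a ha)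
  simpa using this

variable {Φ : Z → Set A} {Ψ : Z → Set B}

/-- Each player has a mixed action that guarantees the value. -/
lemma exists_optimal_mixedActions (u : Z × A × B →ᵇ ℝ)
    (hΦ : ∀ z, IsCompact (Φ z))
    (hΨ : ∀ z, IsCompact (Ψ z)) (hΦne : ∀ z, (Φ z).Nonempty) (hΨne : ∀ z, (Ψ z).Nonempty) (z : Z) :
    ∃ μ ∈ probOn (Φ z), ∃ ν ∈ probOn (Ψ z),
      (∀ μ' ∈ probOn (Φ z), mixedPayoff (slice u z) μ' ν ≤ mixedValue u Φ Ψ z) ∧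
      (∀ ν' ∈ probOn (Ψ z), mixedValue u Φ Ψ z ≤ mixedPayoff (slice u z) μ ν') := by
  obtain ⟨μ, hμ, ν, hν, h⟩ := exists_saddle_mixedPayoff (slice u z) (hΦ z) (hΨ z) (hΦne z) (hΨne z)
  have hs : IsSaddlePoint (P := probOn (Φ z)) (R := probOn (Ψ z))
      (fun p q => mixedPayoff (slice u z) p q) ⟨μ, hμ⟩ ⟨ν, hν⟩ :=
    ⟨fun p => h p p.2 ν hν, fun q => h μ hμ q q.2⟩
  have hval : mixedValue u Φ Ψ z = mixedPayoff (slice u z) μ ν :=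
    hs.iInf_iSup_eq fun p q => abs_mixedPayoff_slice_le u z p q
  refine ⟨μ, hμ, ν, hν, fun μ' hμ' => ?_, fun ν' hν' => ?_⟩
  · exact hval ▸ h μ' hμ' ν hν
  · exact hval ▸ h μ hμ ν' hν'

lemma mixedValue_swapGame (u : Z × A × B →ᵇ ℝ)
    (hΦ : ∀ z, IsCompact (Φ z))
    (hΨ : ∀ z, IsCompact (Ψ z)) (hΦne : ∀ z, (Φ z).Nonempty) (hΨne : ∀ z, (Ψ z).Nonempty) (z : Z) :
    mixedValue (swapGame u) Ψ Φ z = -mixedValue u Φ Ψ z := by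
  obtain ⟨μ, hμ, ν, hν, h1, h2⟩ :=
    exists_optimal_mixedActions u hΦ hΨ hΦne hΨne z
  have hval : mixedPayoff (slice u z) μ ν = mixedValue u Φ Ψ z :=
    le_antisymm (h1 μ hμ) (h2 ν hν)
  have hs : IsSaddlePoint (P := probOn (Ψ z)) (R := probOn (Φ z))
      (fun p q => mixedPayoff (slice (swapGame u) z) p q) ⟨ν, hν⟩ ⟨μ, hμ⟩ := by
    refine ⟨fun p => ?_, fun q => ?_⟩
    · simp only [mixedPayoff_swapGame, hval]
      exact neg_le_neg (h2 p p.2)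
    · simp only [mixedPayoff_swapGame, hval]
      exact neg_le_neg (h1 q q.2)
  rw [mixedValue, hs.iInf_iSup_eq fun p q => abs_mixedPayoff_slice_le (swapGame u) z p q]
  simp only [mixedPayoff_swapGame, hval]

variable [TopologicalSpace.MetrizableSpace Z] [SecondCountableTopology Z]
  [MeasurableSpace Z] [BorelSpace Z]

/-- The mixed payoff is jointly continuous in the parameter and both mixed actions. -/
lemma continuous_mixedPayoff_slice (u : Z × A × B →ᵇ ℝ) :
    Continuous fun q : Z × ProbabilityMeasure A × ProbabilityMeasure B =>
      mixedPayoff (slice u q.1) q.2.1 q.2.2 := by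
  have h : Continuous fun q : Z × ProbabilityMeasure A × ProbabilityMeasure B =>
      mixedPayoff u (diracProba q.1) (q.2.1.prod q.2.2) :=
    (continuous_mixedPayoff u).comp
      ((continuous_diracProba.comp continuous_fst).prodMk
        (ProbabilityMeasure.continuous_prod.comp continuous_snd))
  convert h using 2 with q
  change _ = ∫ p, u p ∂(Measure.dirac q.1).prod ((q.2.1 : Measure A).prod (q.2.2 : Measure B))
  rw [integral_prod _ (u.integrable _), integral_dirac]
  rfl

/-- The set of `(z, c, ν)` such that `ν` holds player 1 down to `c` in the game `z` is closed; only
lower hemicontinuity of player 1's actions enters, since pure replies suffice. -/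
lemma isClosed_forall_mixedPayoff_le (u : Z × A × B →ᵇ ℝ) {Φ : Z → Set A}
    (hlhc : ∀ D : Set A, IsOpen D → IsOpen {z | (Φ z ∩ D).Nonempty})
    (hΦ : ∀ z, MeasurableSet (Φ z)) :
    IsClosed {q : (Z × ℝ) × ProbabilityMeasure B |
      ∀ μ ∈ probOn (Φ q.1.1), mixedPayoff (slice u q.1.1) μ q.2 ≤ q.1.2} := by
  simp only [mixedPayoff_le_iff_forall_dirac _ (hΦ _)]
  rw [← isOpen_compl_iff, isOpen_iff_mem_nhds]
  rintro ⟨⟨z, c⟩, ν⟩ hq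
  simp only [mem_compl_iff, mem_ofPred_eq, not_forall, not_le] at hq
  obtain ⟨a, ha, hlt⟩ := hq
  have hopen : IsOpen {p : ((Z × ℝ) × ProbabilityMeasure B) × A |
      p.1.1.2 < mixedPayoff (slice u p.1.1.1) (diracProba p.2) p.1.2} := by
    refine isOpen_lt (by fun_prop) ((continuous_mixedPayoff_slice u).comp
      (Continuous.prodMk (by fun_prop) (Continuous.prodMk ?_ (by fun_prop))))
    exact continuous_diracProba.comp continuous_snd
  obtain ⟨W, hW, D, hD, hWD⟩ := mem_nhds_prod_iff.1
    (hopen.mem_nhds (show (((z, c), ν), a) ∈ _ from hlt))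
  obtain ⟨D', hD'D, hD', haD'⟩ := mem_nhds_iff.1 hD
  have hN : {q : (Z × ℝ) × ProbabilityMeasure B | (Φ q.1.1 ∩ D').Nonempty} ∈ 𝓝 ((z, c), ν) :=
    ((hlhc D' hD').preimage (continuous_fst.comp continuous_fst)).mem_nhds ⟨a, ha, haD'⟩
  filter_upwards [hW, hN] with q hqW hqN
  obtain ⟨a', ha', haD⟩ := hqN
  simp only [mem_compl_iff, mem_ofPred_eq, not_forall, not_le]
  exact ⟨a', ha', hWD (mk_mem_prod hqW (hD'D haD))⟩

variable (u : Z × A × B →ᵇ ℝ)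

/-- The epigraph of the value is the set of `(z, c)` for which some `ν` holds player 1 down to
`c`. -/
lemma lowerSemicontinuous_mixedValue (hΦ : ∀ z, IsCompact (Φ z))
    (hΨ : ∀ z, IsCompact (Ψ z)) (hΦne : ∀ z, (Φ z).Nonempty) (hΨne : ∀ z, (Ψ z).Nonempty)
    (hlhc : ∀ D : Set A, IsOpen D → IsOpen {z | (Φ z ∩ D).Nonempty})
    (huhc : ∀ C : Set B, IsClosed C → IsClosed {z | (Ψ z ∩ C).Nonempty}) :
    LowerSemicontinuous (mixedValue u Φ Ψ) := by
  rw [lowerSemicontinuous_iff_isClosed_epigraph]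
  have h := isClosed_exists_mem_probOn (X := Z × ℝ) (Φ := fun p => Ψ p.1) (fun p => hΨ p.1)
    (fun C hC => (huhc C hC).preimage continuous_fst)
    (isClosed_forall_mixedPayoff_le u hlhc fun z => (hΦ z).measurableSet)
  convert h using 1
  ext ⟨z, c⟩
  obtain ⟨μ, hμ, ν, hν, h1, h2⟩ :=
    exists_optimal_mixedActions u hΦ hΨ hΦne hΨne z
  simp only [mem_ofPred_eq]
  exact ⟨fun hc => ⟨ν, hν, fun μ' hμ' => (h1 μ' hμ').trans hc⟩,
    fun ⟨ν', hν', hc⟩ => (h2 ν' hν').trans (hc μ hμ)⟩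

/-- The value inherits lower semicontinuity from the closed graph of the minimizer's problem, and
upper semicontinuity from that of the maximizer by exchanging the players. -/
theorem continuous_mixedValue (hΦ : ∀ z, IsCompact (Φ z))
    (hΨ : ∀ z, IsCompact (Ψ z)) (hΦne : ∀ z, (Φ z).Nonempty) (hΨne : ∀ z, (Ψ z).Nonempty)
    (hΦc : ContinuousCorrespondence Φ) (hΨc : ContinuousCorrespondence Ψ) :
    Continuous (mixedValue u Φ Ψ) := by
  rw [continuous_iff_lower_upperSemicontinuous]
  refine ⟨lowerSemicontinuous_mixedValue u hΦ hΨ hΦne hΨne hΦc.2 hΨc.1, ?_⟩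
  have h := lowerSemicontinuous_mixedValue (swapGame u) hΨ hΦ hΨne hΦne hΨc.2 hΦc.1
  intro z c hc
  have hneg := mixedValue_swapGame u hΦ hΨ hΦne hΨne
  have hev := h z (-c) ((neg_lt_neg hc).trans_eq (hneg z).symm)
  filter_upwards [hev] with z' hz'
  exact neg_lt_neg_iff.1 (hz'.trans_eq (hneg z'))

/-- Player 2 has a measurable family of mixed actions holding player 1 down to a continuous level
that can be held for every parameter. -/
lemma exists_measurable_forall_mixedPayoff_le (hΦ : ∀ z, IsCompact (Φ z))
    (hΨ : ∀ z, IsCompact (Ψ z))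
    (hlhc : ∀ D : Set A, IsOpen D → IsOpen {z | (Φ z ∩ D).Nonempty})
    (huhc : ∀ C : Set B, IsClosed C → IsClosed {z | (Ψ z ∩ C).Nonempty}) {V : Z → ℝ}
    (hV : Continuous V)
    (hex : ∀ z, ∃ ν ∈ probOn (Ψ z), ∀ μ ∈ probOn (Φ z), mixedPayoff (slice u z) μ ν ≤ V z) :
    ∃ ν : Rule Ψ, ∀ z, ∀ μ ∈ probOn (Φ z), mixedPayoff (slice u z) μ (ν.1 z) ≤ V z := by
  have hcl : IsClosed {q : Z × ProbabilityMeasure B |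
      ∀ μ ∈ probOn (Φ q.1), mixedPayoff (slice u q.1) μ q.2 ≤ V q.1} :=
    (isClosed_forall_mixedPayoff_le u hlhc fun z => (hΦ z).measurableSet).preimage
      (f := fun q : Z × ProbabilityMeasure B => ((q.1, V q.1), q.2)) (by fun_prop)
  obtain ⟨h, hcont, hsep⟩ := exists_seq_continuous_separating (Y := B)
  obtain ⟨s, hs, hmeas⟩ := exists_measurable_selection h hcont hsep
    (fun z => {ν ∈ probOn (Ψ z) | ∀ μ ∈ probOn (Φ z), mixedPayoff (slice u z) μ ν ≤ V z})
    (fun z => (isCompact_probOn (hΨ z)).inter_right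
      (hcl.preimage (f := fun ν => (z, ν)) (by fun_prop))) hex fun C hC => by
        have := isClosed_exists_mem_probOn hΨ huhc (hcl.inter (hC.preimage continuous_snd))
        convert this.measurableSet using 1
        ext z
        simp only [Set.Nonempty, mem_inter_iff, mem_ofPred_eq, mem_preimage, and_assoc]
  exact ⟨⟨s, measurable_of_measurableSet_preimage_closed hmeas, fun z => (hs z).1⟩,
    fun z => (hs z).2⟩

/-- Measurable guarantees of the value for each player, paired, are saddle points. -/
theorem exists_measurable_saddle (hΦ : ∀ z, IsCompact (Φ z))
    (hΨ : ∀ z, IsCompact (Ψ z)) (hΦne : ∀ z, (Φ z).Nonempty) (hΨne : ∀ z, (Ψ z).Nonempty)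
    (hΦc : ContinuousCorrespondence Φ) (hΨc : ContinuousCorrespondence Ψ) :
    ∃ (μ : Rule Φ) (ν : Rule Ψ), ∀ z,
      IsSaddlePoint (P := probOn (Φ z)) (R := probOn (Ψ z))
        (fun p q => mixedPayoff (slice u z) p q) ⟨μ.1 z, μ.2.2 z⟩ ⟨ν.1 z, ν.2.2 z⟩ := by
  have hV := continuous_mixedValue u hΦ hΨ hΦne hΨne hΦc hΨc
  have hex := exists_optimal_mixedActions u hΦ hΨ hΦne hΨne
  obtain ⟨ν, hν⟩ := exists_measurable_forall_mixedPayoff_le u hΦ hΨ hΦc.2 hΨc.1 hV fun z => by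
    obtain ⟨-, -, ν, hν, h, -⟩ := hex z
    exact ⟨ν, hν, h⟩
  obtain ⟨μ, hμ⟩ := exists_measurable_forall_mixedPayoff_le (swapGame u) hΨ hΦ hΨc.2 hΦc.1 hV.neg
    fun z => by
      obtain ⟨μ, hμ, -, -, -, h⟩ := hex z
      refine ⟨μ, hμ, fun ν hν => ?_⟩
      rw [mixedPayoff_swapGame]
      exact neg_le_neg (h ν hν)
  have hμ' : ∀ z, ∀ ν ∈ probOn (Ψ z), mixedValue u Φ Ψ z ≤ mixedPayoff (slice u z) (μ.1 z) ν :=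
    fun z ν hν => by
      have := hμ z ν hν
      rw [mixedPayoff_swapGame] at this
      exact neg_le_neg_iff.1 this
  exact ⟨μ, ν, fun z => ⟨fun p => (hν z p p.2).trans (hμ' z _ (ν.2.2 z)),
    fun q => (hν z _ (μ.2.2 z)).trans (hμ' z q q.2)⟩⟩

end Parametric

/-! ### The one-stage game -/

namespace Game

variable {E A B : Type*} [MeasurableSpace E] [MeasurableSpace A] [MeasurableSpace B]
  (G : Game E A B)

lemma coe_rescale (k : ℕ) (γ : G.Risk) : (G.rescale k γ : ℝ) = G.β ^ k * γ := rfl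

lemma rescale_zero (γ : G.Risk) : G.rescale 0 γ = γ :=
  Subtype.ext (by simp [coe_rescale])

lemma rescale_one_rescale (k : ℕ) (γ : G.Risk) :
    G.rescale 1 (G.rescale k γ) = G.rescale (k + 1) γ :=
  Subtype.ext (by simp only [coe_rescale]; ring)

lemma continuous_rescale (k : ℕ) : Continuous (G.rescale k) :=
  Continuous.subtype_mk (by fun_prop) _

lemma lintegral_tildeQMix (x : E) (γ : G.Risk) (μ : ProbabilityMeasure A)
    (ν : ProbabilityMeasure B) {f : E → ENNReal} (hf : Measurable f) :
    ∫⁻ x', f x' ∂G.tildeQMix x γ μ ν =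
      ∫⁻ p, ENNReal.ofReal (Real.exp (γ * G.r (x, p))) * ∫⁻ x', f x' ∂G.Q (x, p)
        ∂(μ : Measure A).prod (ν : Measure B) := by
  have hmeas : Measurable fun p : A × B => G.tildeQ (x, γ, p.1, p.2) :=
    G.tildeQ.measurable.comp (by fun_prop)
  rw [tildeQMix, Measure.lintegral_bind hmeas.aemeasurable hf.aemeasurable]
  refine lintegral_congr fun p => ?_
  change ∫⁻ x', f x' ∂(ENNReal.ofReal (Real.exp (γ * G.r (x, p))) • G.Q (x, p)) = _
  rw [lintegral_smul_measure, smul_eq_mul]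

variable [TopologicalSpace E] [TopologicalSpace.MetrizableSpace E] [SecondCountableTopology E]
  [BorelSpace E]
  [TopologicalSpace A] [TopologicalSpace B]

/-- Weak continuity of `Q` allows the integrand to vary with a parameter: the product of `Q` with a
Dirac measure at the parameter is weakly continuous. -/
lemma continuous_integral_transition
    (hQ : ∀ v : E →ᵇ ℝ, Continuous fun p => ∫ x', v x' ∂(G.Q p)) (v : E × G.Risk →ᵇ ℝ) :
    Continuous fun q : (E × A × B) × G.Risk => ∫ x', v (x', q.2) ∂(G.Q q.1) := by
  let κ : E × A × B → ProbabilityMeasure E := fun p => ⟨G.Q p, inferInstance⟩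
  have hκ : Continuous κ := ProbabilityMeasure.continuous_iff_forall_continuous_integral.2 hQ
  have h : Continuous fun q : (E × A × B) × G.Risk => mixedPayoff v (κ q.1) (diracProba q.2) :=
    (continuous_mixedPayoff v).comp
      ((hκ.comp continuous_fst).prodMk (continuous_diracProba.comp continuous_snd))
  convert h using 2 with q
  change _ = ∫ p, v p ∂(G.Q q.1).prod (Measure.dirac q.2)
  rw [integral_prod _ (v.integrable _)]
  simp only [integral_dirac]

variable [BorelSpace A] [SecondCountableTopology B] [BorelSpace B]

/-- The one-stage game with terminal reward `v` as a parametrized game with bounded continuous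
payoff `exp (γ r(x, a, b)) ∫ v(x', β γ) Q(dx' | x, a, b)`. -/
theorem exists_stageGame (hr : Continuous G.r)
    (hQ : ∀ v : E →ᵇ ℝ, Continuous fun p => ∫ x', v x' ∂(G.Q p)) (v : E × G.Risk →ᵇ ℝ)
    (hv : ∀ z, 0 ≤ v z) :
    ∃ u : (E × G.Risk) × A × B →ᵇ ℝ, ∀ x γ μ ν,
      G.L v x γ μ ν = mixedPayoff (slice u (x, γ)) μ ν ∧
      ENNReal.ofReal (G.L v x γ μ ν) =
        ∫⁻ p, ENNReal.ofReal (Real.exp (γ * G.r (x, p))) *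
          ∫⁻ x', ENNReal.ofReal (v (x', G.rescale 1 γ)) ∂G.Q (x, p)
          ∂(μ : Measure A).prod (ν : Measure B) := by
  let w : (E × G.Risk) × A × B → ℝ := fun p =>
    Real.exp (p.1.2 * G.r (p.1.1, p.2)) * ∫ x', v (x', G.rescale 1 p.1.2) ∂G.Q (p.1.1, p.2)
  have hw : Continuous w := by
    refine Continuous.mul ?_ ?_
    · exact Real.continuous_exp.comp (Continuous.mul (by fun_prop) (hr.comp (by fun_prop)))
    · exact (G.continuous_integral_transition hQ v).comp
        (Continuous.prodMk (by fun_prop) ((G.continuous_rescale 1).comp (by fun_prop)))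
  have hw0 : ∀ p, 0 ≤ w p := fun p =>
    mul_nonneg (Real.exp_nonneg _) (integral_nonneg fun _ => hv _)
  have hbound : ∀ p, ‖w p‖ ≤ Real.exp (G.γbar * G.rbar) * ‖v‖ := by
    intro p
    rw [norm_mul, Real.norm_eq_abs, Real.abs_exp]
    refine mul_le_mul ?_ ?_ (norm_nonneg _) (Real.exp_nonneg _)
    · refine Real.exp_le_exp.2 (mul_le_mul p.1.2.2.2 (G.r_le _) (G.r_nonneg _) G.γbar_pos.le)
    · have := norm_integral_le_of_norm_le_const (μ := G.Q (p.1.1, p.2))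
        (f := fun x' => v (x', G.rescale 1 p.1.2))
        (Eventually.of_forall fun x' => v.norm_coe_le_norm _)
      simpa using this
  let u : (E × G.Risk) × A × B →ᵇ ℝ :=
    BoundedContinuousFunction.ofNormedAddCommGroup w hw _ hbound
  refine ⟨u, fun x γ μ ν => ?_⟩
  have hvc : Continuous fun x' => v (x', G.rescale 1 γ) := v.continuous.comp (by fun_prop)
  let vγ : E →ᵇ ℝ := v.compContinuous ⟨fun x' => (x', G.rescale 1 γ), by fun_prop⟩
  have hu : ∀ p, ENNReal.ofReal (slice u (x, γ) p) =
      ENNReal.ofReal (Real.exp (γ * G.r (x, p))) *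
        ∫⁻ x', ENNReal.ofReal (v (x', G.rescale 1 γ)) ∂G.Q (x, p) := fun p => by
    have hint : Integrable (fun x' => v (x', G.rescale 1 γ)) (G.Q (x, p)) := vγ.integrable _
    rw [← ofReal_integral_eq_lintegral_ofReal hint (Eventually.of_forall fun _ => hv _),
      ← ENNReal.ofReal_mul (Real.exp_nonneg _)]
    rfl
  have hs0 : ∀ p, 0 ≤ slice u (x, γ) p := fun p => hw0 ((x, γ), p)
  have hL : G.L v x γ μ ν = mixedPayoff (slice u (x, γ)) μ ν := by
    rw [L, mixedPayoff, integral_eq_lintegral_of_nonneg_ae (Eventually.of_forall fun _ => hv _)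
      hvc.measurable.aestronglyMeasurable, integral_eq_lintegral_of_nonneg_ae
      (Eventually.of_forall hs0)
      (slice u (x, γ)).continuous.measurable.aestronglyMeasurable,
      G.lintegral_tildeQMix x γ μ ν hvc.measurable.ennreal_ofReal]
    simp only [hu]
  refine ⟨hL, ?_⟩
  rw [hL, mixedPayoff, ofReal_integral_eq_lintegral_ofReal ((slice u (x, γ)).integrable _)
    (Eventually.of_forall hs0)]
  simp only [hu]

end Game

/-! ### Backward evaluation of a pair of policies -/

namespace Game

variable {E A B : Type*} [MeasurableSpace E] [MeasurableSpace A] [MeasurableSpace B]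
  (G : Game E A B) (π : G.PolicyA) (σ : G.PolicyB)

lemma lintegral_decisionKernel (f : G.RuleA) (g : G.RuleB) (x : E) {h : E × A × B → ENNReal}
    (hh : Measurable h) :
    ∫⁻ p, h p ∂G.decisionKernel f g x =
      ∫⁻ p, h (x, p) ∂(f.1 x : Measure A).prod (g.1 x : Measure B) := by
  rw [decisionKernel, Kernel.lintegral_id_prod hh, Kernel.prod_apply]
  rfl

instance (x : E) : IsProbabilityMeasure (G.pathMeasure π σ x) := by
  unfold pathMeasure; infer_instance

lemma map_eval_zero_pathMeasure (x : E) :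
    (G.pathMeasure π σ x).map (fun ω => ω 0) = G.decisionKernel (π 0) (σ 0) x := by
  have h1 : (fun ω : ℕ → E × A × B => ω 0) =
      (MeasurableEquiv.piUnique fun _ : Finset.Iic 0 => E × A × B) ∘ Preorder.frestrictLe 0 := rfl
  rw [h1, ← Measure.map_map (by fun_prop) (by fun_prop), pathMeasure, Kernel.trajMeasure,
    Measure.map_comp _ _ (by fun_prop), Kernel.traj_map_frestrictLe, Kernel.partialTraj_self,
    Measure.id_comp, Measure.map_map (by fun_prop) (by fun_prop)]
  exact Measure.map_id

/-- The conditional law of stage `k + 1` given the past, in integrated form. -/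
lemma lintegral_pathMeasure_succ (x : E) (k : ℕ) {F : (Finset.Iic k → E × A × B) → ENNReal}
    (hF : Measurable F) {h : E × A × B → ENNReal} (hh : Measurable h) :
    ∫⁻ ω, F (Preorder.frestrictLe k ω) * h (ω (k + 1)) ∂G.pathMeasure π σ x =
      ∫⁻ ω, F (Preorder.frestrictLe k ω) *
        ∫⁻ x', ∫⁻ p, h p ∂G.decisionKernel (π (k + 1)) (σ (k + 1)) x' ∂G.Q (ω k)
        ∂G.pathMeasure π σ x := by
  have hΦ : Measurable fun q : (Finset.Iic k → E × A × B) × (E × A × B) => F q.1 * h q.2 := by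
    fun_prop
  have hmap := Kernel.map_frestrictLe_trajMeasure_compProd_eq_map_trajMeasure
    (X := fun _ => E × A × B) (κ := G.historyKernel π σ)
    (μ₀ := G.decisionKernel (π 0) (σ 0) x) (a := k)
  have hleft : ∫⁻ ω, F (Preorder.frestrictLe k ω) * h (ω (k + 1)) ∂G.pathMeasure π σ x =
      ∫⁻ q, F q.1 * h q.2 ∂(G.pathMeasure π σ x).map
        (fun ω => (Preorder.frestrictLe k ω, ω (k + 1))) := by
    rw [lintegral_map hΦ (by fun_prop)]
  have hker : Measurable fun p : E × A × B =>
      ∫⁻ x', ∫⁻ p, h p ∂G.decisionKernel (π (k + 1)) (σ (k + 1)) x' ∂G.Q p :=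
    (hh.lintegral_kernel (κ := G.decisionKernel (π (k + 1)) (σ (k + 1)))).lintegral_kernel
  rw [hleft, pathMeasure, ← hmap, Measure.lintegral_compProd hΦ]
  have hinner : ∀ y : Finset.Iic k → E × A × B,
      ∫⁻ b, F y * h b ∂G.historyKernel π σ k y = F y *
        ∫⁻ x', ∫⁻ p, h p ∂G.decisionKernel (π (k + 1)) (σ (k + 1)) x'
          ∂G.Q (y ⟨k, Finset.mem_Iic.2 le_rfl⟩) := fun y => by
    rw [lintegral_const_mul _ hh, historyKernel, Kernel.comap_apply, stepKernel,
      Kernel.lintegral_comp _ _ _ hh]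
  simp only [hinner]
  exact lintegral_map (hF.mul (hker.comp (measurable_pi_apply _))) (by fun_prop)

/-- The expected exponential reward of the `n` stages from stage `k` on, given the state at
stage `k`; the risk parameter at stage `k` is `β ^ k γ`. -/
def tailPayoff (γ : G.Risk) : ℕ → ℕ → E → ENNReal
  | 0, _, _ => 1
  | n + 1, k, x =>
    ∫⁻ p, ENNReal.ofReal (Real.exp (G.rescale k γ * G.r p)) *
      ∫⁻ x', tailPayoff γ n (k + 1) x' ∂G.Q p ∂G.decisionKernel (π k) (σ k) x

lemma measurable_exp_reward (c : ℝ) :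
    Measurable fun p : E × A × B => ENNReal.ofReal (Real.exp (c * G.r p)) := by
  have := G.measurable_r
  fun_prop

lemma measurable_tailPayoff (γ : G.Risk) (n k : ℕ) : Measurable (G.tailPayoff π σ γ n k) := by
  induction n generalizing k with
  | zero => exact measurable_const
  | succ n ih =>
    exact ((G.measurable_exp_reward _).mul (ih (k + 1)).lintegral_kernel).lintegral_kernel

lemma measurable_totalReward (N : ℕ) : Measurable (G.totalReward N) :=
  Finset.measurable_sum _ fun k _ =>
    (G.measurable_r.comp (measurable_pi_apply k)).const_mul _

/-- The expectation after `k + 1` stages: the law of `ω (k + 1)` given the past depends on `ω k`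
only, so the remaining `n` stages contribute their `tailPayoff` from the next state. -/
lemma lintegral_exp_totalReward_add (x : E) (γ : G.Risk) (n k : ℕ) :
    ∫⁻ ω, ENNReal.ofReal (Real.exp (γ * G.totalReward (k + 1 + n) ω)) ∂G.pathMeasure π σ x =
      ∫⁻ ω, ENNReal.ofReal (Real.exp (γ * G.totalReward (k + 1) ω)) *
        ∫⁻ x', G.tailPayoff π σ γ n (k + 1) x' ∂G.Q (ω k) ∂G.pathMeasure π σ x := by
  induction n generalizing k with
  | zero => simp [tailPayoff]
  | succ n ih =>
    have hsum : ∀ ω : ℕ → E × A × B, G.totalReward (k + 1) ω =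
        ∑ j : Finset.Iic k, G.β ^ (j : ℕ) * G.r (Preorder.frestrictLe k ω j) := fun ω => by
      rw [totalReward, Nat.range_succ_eq_Iic]
      exact (Finset.sum_coe_sort (Finset.Iic k) fun j => G.β ^ j * G.r (ω j)).symm
    have hF : Measurable fun y : Finset.Iic k → E × A × B =>
        ENNReal.ofReal (Real.exp (γ * ∑ j : Finset.Iic k, G.β ^ (j : ℕ) * G.r (y j))) := by
      have := G.measurable_r
      fun_prop
    have hstep := G.lintegral_pathMeasure_succ π σ x k hF
      ((G.measurable_exp_reward (G.rescale (k + 1) γ)).mul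
        ((G.measurable_tailPayoff π σ γ n (k + 1 + 1)).lintegral_kernel (κ := G.Q)))
    simp only [← hsum] at hstep
    simp only [tailPayoff]
    rw [show k + 1 + (n + 1) = k + 1 + 1 + n by ring, ih (k + 1)]
    -- The factor of stage `k + 1` moves into the accumulated reward.
    refine Eq.trans (lintegral_congr fun ω => ?_) hstep
    rw [Pi.mul_apply, ← mul_assoc, ← ENNReal.ofReal_mul (Real.exp_nonneg _), ← Real.exp_add]
    congr 3
    rw [totalReward, Finset.sum_range_succ, ← totalReward, coe_rescale]
    ring

/-- The criterion is obtained by backward evaluation. -/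
theorem lintegral_exp_totalReward (x : E) (γ : G.Risk) (N : ℕ) :
    ∫⁻ ω, ENNReal.ofReal (Real.exp (γ * G.totalReward N ω)) ∂G.pathMeasure π σ x =
      G.tailPayoff π σ γ N 0 x := by
  cases N with
  | zero => simp [totalReward, tailPayoff]
  | succ n =>
    have hmeas : Measurable fun p : E × A × B => ENNReal.ofReal (Real.exp (G.rescale 0 γ * G.r p)) *
        ∫⁻ x', G.tailPayoff π σ γ n 1 x' ∂G.Q p :=
      (G.measurable_exp_reward _).mul (G.measurable_tailPayoff π σ γ n 1).lintegral_kernel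
    rw [tailPayoff, show n + 1 = 0 + 1 + n by ring, lintegral_exp_totalReward_add,
      ← map_eval_zero_pathMeasure, lintegral_map hmeas (measurable_pi_apply 0)]
    simp [totalReward, rescale_zero]

lemma totalReward_le (N : ℕ) (ω : ℕ → E × A × B) : G.totalReward N ω ≤ N * G.rbar := by
  refine (Finset.sum_le_card_nsmul _ _ G.rbar fun k _ => ?_).trans_eq (by simp)
  exact (mul_le_of_le_one_left (G.r_nonneg _) (pow_le_one₀ G.β_pos.le G.β_le_one)).trans (G.r_le _)

lemma norm_exp_totalReward_le (N : ℕ) (γ : G.Risk) (ω : ℕ → E × A × B) :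
    ‖Real.exp (γ * G.totalReward N ω)‖ ≤ Real.exp (γ * (N * G.rbar)) := by
  rw [Real.norm_eq_abs, Real.abs_exp]
  exact Real.exp_le_exp.2 (mul_le_mul_of_nonneg_left (G.totalReward_le N ω) γ.2.1.le)

lemma abs_payoff_le (N : ℕ) (x : E) (γ : G.Risk) :
    |G.payoff N π σ x γ| ≤ Real.exp (γ * (N * G.rbar)) := by
  have := norm_integral_le_of_norm_le_const (μ := G.pathMeasure π σ x)
    (Eventually.of_forall fun ω => G.norm_exp_totalReward_le N γ ω)
  simpa [payoff] using this

lemma payoff_nonneg (N : ℕ) (x : E) (γ : G.Risk) : 0 ≤ G.payoff N π σ x γ :=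
  integral_nonneg fun _ => Real.exp_nonneg _

theorem ofReal_payoff (N : ℕ) (x : E) (γ : G.Risk) :
    ENNReal.ofReal (G.payoff N π σ x γ) = G.tailPayoff π σ γ N 0 x := by
  have hmeas : Measurable fun ω => Real.exp (γ * G.totalReward N ω) :=
    Real.measurable_exp.comp ((G.measurable_totalReward N).const_mul _)
  have hint : Integrable (fun ω => Real.exp (γ * G.totalReward N ω)) (G.pathMeasure π σ x) :=
    Integrable.of_bound hmeas.aestronglyMeasurable (Real.exp (γ * (N * G.rbar)))
      (Eventually.of_forall fun ω => G.norm_exp_totalReward_le N γ ω)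
  rw [payoff, ofReal_integral_eq_lintegral_ofReal hint
    (Eventually.of_forall fun _ => Real.exp_nonneg _), lintegral_exp_totalReward]

end Game

/-! ### The Shapley recursion -/

lemma ContinuousCorrespondence.comp_fst {X Y Z : Type*} [TopologicalSpace X] [TopologicalSpace Y]
    [TopologicalSpace Z] {Φ : X → Set Y} (hΦ : ContinuousCorrespondence Φ) :
    ContinuousCorrespondence fun z : X × Z => Φ z.1 :=
  ⟨fun C hC => (hΦ.1 C hC).preimage continuous_fst, fun D hD => (hΦ.2 D hD).preimage continuous_fst⟩

/-- Every measure on the admissible set of a given point is the value of a rule there: elsewhere the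
rule follows a measurable selector. -/
lemma surjective_rule_eval {X Y : Type*} [MeasurableSpace X] [MeasurableSingletonClass X]
    [MeasurableSpace Y] [TopologicalSpace Y] [OpensMeasurableSpace Y] {Φ : X → Set Y}
    (hsel : ∃ s : X → Y, Measurable s ∧ ∀ x, s x ∈ Φ x) (x : X) :
    Function.Surjective fun f : Rule Φ => (⟨f.1 x, f.2.2 x⟩ : probOn (Φ x)) := by
  classical
  obtain ⟨s, hs, hsΦ⟩ := hsel
  rintro ⟨μ, hμ⟩
  have hdirac : Measurable fun y => diracProba (s y) :=
    Measurable.subtype_mk (Measure.measurable_dirac.comp hs)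
  refine ⟨⟨fun y => if y = x then μ else diracProba (s y),
    Measurable.ite (measurableSet_singleton x) measurable_const hdirac, fun y => ?_⟩, ?_⟩
  · dsimp only
    split_ifs with h
    · exact h ▸ hμ
    · exact diracProba_mem_probOn (hsΦ y)
  · simp

namespace Game

variable {E A B : Type*} [MeasurableSpace E] [MeasurableSpace A] [MeasurableSpace B]

/-- The sequence generated from the constant `1` by solving the one-stage games. -/
def value (G : Game E A B) : ℕ → E × G.Risk → ℝ
  | 0, _ => 1
  | n + 1, z => ⨅ ν : probOn (G.admB z.1), ⨆ μ : probOn (G.admA z.1), G.L (G.value n) z.1 z.2 μ ν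

lemma value_nonneg (G : Game E A B) (n : ℕ) (z : E × G.Risk) : 0 ≤ G.value n z := by
  induction n generalizing z with
  | zero => exact zero_le_one
  | succ n ih =>
    exact Real.iInf_nonneg fun _ => Real.iSup_nonneg fun _ => integral_nonneg fun _ => ih _

/-- The operator `T` acts pointwise: only the values of the rules at `z` enter. -/
lemma T_eq_iInf_iSup [MeasurableSingletonClass E] [TopologicalSpace A] [OpensMeasurableSpace A]
    [TopologicalSpace B] [OpensMeasurableSpace B] (G : Game E A B) (v : E × G.Risk → ℝ)
    (z : E × G.Risk) :
    G.T v z = ⨅ ν : probOn (G.admB z.1), ⨆ μ : probOn (G.admA z.1), G.L v z.1 z.2 μ ν := by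
  rw [← (surjective_rule_eval G.exists_selector_admB z.1).iInf_comp]
  refine iInf_congr fun g => ?_
  exact (surjective_rule_eval G.exists_selector_admA z.1).iSup_comp
    (g := fun μ : probOn (G.admA z.1) => G.L v z.1 z.2 μ (g.1 z.1))

section Regularity

variable [TopologicalSpace E] [TopologicalSpace.MetrizableSpace E] [SecondCountableTopology E]
  [BorelSpace E]
  [TopologicalSpace A] [TopologicalSpace.MetrizableSpace A] [SecondCountableTopology A]
  [BorelSpace A]
  [TopologicalSpace B] [TopologicalSpace.MetrizableSpace B] [SecondCountableTopology B]
  [BorelSpace B]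
  (G : Game E A B)
  (hcomp : ∀ x, IsCompact (G.admA x) ∧ IsCompact (G.admB x))
  (hcorr : ContinuousCorrespondence G.admA ∧ ContinuousCorrespondence G.admB)
  (hr : Continuous G.r)
  (hQ : ∀ v : E →ᵇ ℝ, Continuous fun p => ∫ x', v x' ∂(G.Q p))

include hcomp hcorr hr hQ

/-- Continuity and boundedness propagate through the recursion. -/
lemma exists_boundedContinuous_eq_value (n : ℕ) :
    ∃ w : E × G.Risk →ᵇ ℝ, ⇑w = G.value n := by
  obtain ⟨s, -, hs⟩ := G.exists_selector_admA
  obtain ⟨t, -, ht⟩ := G.exists_selector_admB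
  induction n with
  | zero => exact ⟨BoundedContinuousFunction.const _ 1, rfl⟩
  | succ n ih =>
    obtain ⟨w, hw⟩ := ih
    obtain ⟨u, hu⟩ := G.exists_stageGame hr hQ w fun z => hw ▸ G.value_nonneg n z
    have hval : G.value (n + 1) =
        mixedValue u (fun z => G.admA z.1) (fun z => G.admB z.1) := by
      ext z
      simp only [value, ← hw, mixedValue, (hu _ _ _ _).1]
    have hcont := continuous_mixedValue u (fun z => (hcomp z.1).1) (fun z => (hcomp z.1).2)
      (fun z => ⟨s z.1, hs z.1⟩) (fun z => ⟨t z.1, ht z.1⟩) hcorr.1.comp_fst hcorr.2.comp_fst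
    refine ⟨BoundedContinuousFunction.ofNormedAddCommGroup _ hcont ‖u‖ fun z => ?_, hval.symm⟩
    have : Nonempty (probOn (G.admA z.1)) := (probOn_nonempty ⟨s z.1, hs z.1⟩).to_subtype
    have : Nonempty (probOn (G.admB z.1)) := (probOn_nonempty ⟨t z.1, ht z.1⟩).to_subtype
    exact abs_iInf_le_of_abs_le fun ν => abs_iSup_le_of_abs_le fun μ =>
      abs_mixedPayoff_slice_le u z μ ν

lemma exists_isSaddleSelector_value (n : ℕ) :
    ∃ (μ : G.SelectorA) (ν : G.SelectorB), G.IsSaddleSelector (G.value n) μ ν := by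
  obtain ⟨s, -, hs⟩ := G.exists_selector_admA
  obtain ⟨t, -, ht⟩ := G.exists_selector_admB
  obtain ⟨w, hw⟩ := G.exists_boundedContinuous_eq_value hcomp hcorr hr hQ n
  obtain ⟨u, hu⟩ := G.exists_stageGame hr hQ w fun z => hw ▸ G.value_nonneg n z
  obtain ⟨μ, ν, h⟩ := exists_measurable_saddle u (Φ := fun z => G.admA z.1)
    (Ψ := fun z => G.admB z.1) (fun z => (hcomp z.1).1) (fun z => (hcomp z.1).2)
    (fun z => ⟨s z.1, hs z.1⟩) (fun z => ⟨t z.1, ht z.1⟩) hcorr.1.comp_fst hcorr.2.comp_fst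
  refine ⟨μ, ν, fun z => ?_⟩
  simpa only [← hw, (hu _ _ _ _).1] using h z

lemma exists_abs_L_value_le (n : ℕ) :
    ∃ C : ℝ, ∀ x γ μ ν, |G.L (G.value n) x γ μ ν| ≤ C := by
  obtain ⟨w, hw⟩ := G.exists_boundedContinuous_eq_value hcomp hcorr hr hQ n
  obtain ⟨u, hu⟩ := G.exists_stageGame hr hQ w fun z => hw ▸ G.value_nonneg n z
  refine ⟨‖u‖, fun x γ μ ν => ?_⟩
  rw [← hw, (hu x γ μ ν).1]
  exact abs_mixedPayoff_slice_le u _ μ ν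

lemma ofReal_L_value (n : ℕ) (x : E) (γ : G.Risk) (μ : ProbabilityMeasure A)
    (ν : ProbabilityMeasure B) :
    ENNReal.ofReal (G.L (G.value n) x γ μ ν) =
      ∫⁻ p, ENNReal.ofReal (Real.exp (γ * G.r (x, p))) *
        ∫⁻ x', ENNReal.ofReal (G.value n (x', G.rescale 1 γ)) ∂G.Q (x, p)
        ∂(μ : Measure A).prod (ν : Measure B) := by
  obtain ⟨w, hw⟩ := G.exists_boundedContinuous_eq_value hcomp hcorr hr hQ n
  obtain ⟨u, hu⟩ := G.exists_stageGame hr hQ w fun z => hw ▸ G.value_nonneg n z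
  rw [← hw]
  exact (hu x γ μ ν).2

lemma value_succ_eq_of_isSaddleSelector {n : ℕ} {μ : G.SelectorA} {ν : G.SelectorB}
    (h : G.IsSaddleSelector (G.value n) μ ν) (z : E × G.Risk) :
    G.value (n + 1) z = G.L (G.value n) z.1 z.2 (μ.1 z) (ν.1 z) := by
  obtain ⟨C, hC⟩ := G.exists_abs_L_value_le hcomp hcorr hr hQ n
  exact (h z).iInf_iSup_eq fun p q => hC z.1 z.2 p q

lemma value_succ_eq_iSup_iInf (n : ℕ) (z : E × G.Risk) :
    G.value (n + 1) z =
      ⨆ μ : probOn (G.admA z.1), ⨅ ν : probOn (G.admB z.1), G.L (G.value n) z.1 z.2 μ ν := by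
  obtain ⟨C, hC⟩ := G.exists_abs_L_value_le hcomp hcorr hr hQ n
  obtain ⟨μ, ν, h⟩ := G.exists_isSaddleSelector_value hcomp hcorr hr hQ n
  rw [G.value_succ_eq_of_isSaddleSelector hcomp hcorr hr hQ h]
  exact ((h z).iSup_iInf_eq fun p q => hC z.1 z.2 p q).symm

/-- One step of the backward evaluation is the operator `L` when the continuation is `value n`. -/
lemma lintegral_decisionKernel_value (π : G.PolicyA) (σ : G.PolicyB) (γ : G.Risk) (n k : ℕ)
    (x : E) :
    ∫⁻ p, ENNReal.ofReal (Real.exp (G.rescale k γ * G.r p)) *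
      ∫⁻ x', ENNReal.ofReal (G.value n (x', G.rescale (k + 1) γ)) ∂G.Q p
        ∂G.decisionKernel (π k) (σ k) x =
      ENNReal.ofReal (G.L (G.value n) x (G.rescale k γ) ((π k).1 x) ((σ k).1 x)) := by
  obtain ⟨w, hw⟩ := G.exists_boundedContinuous_eq_value hcomp hcorr hr hQ n
  have hm : Measurable fun x' => ENNReal.ofReal (G.value n (x', G.rescale (k + 1) γ)) := by
    rw [← hw]
    have hc : Continuous fun x' => w (x', G.rescale (k + 1) γ) := by fun_prop
    exact hc.measurable.ennreal_ofReal
  rw [G.ofReal_L_value hcomp hcorr hr hQ]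
  simp only [rescale_one_rescale]
  exact G.lintegral_decisionKernel (π k) (σ k) x
    ((G.measurable_exp_reward _).mul hm.lintegral_kernel)

/-- If player 2's rules hold each one-stage game down to its value, then they do so for the rest of
the game. -/
lemma tailPayoff_le_value {π : G.PolicyA} {σ : G.PolicyB} {γ : G.Risk} {N : ℕ}
    (h : ∀ n k, n + 1 + k = N → ∀ x, G.L (G.value n) x (G.rescale k γ) ((π k).1 x) ((σ k).1 x) ≤
      G.value (n + 1) (x, G.rescale k γ)) (n k : ℕ) (hnk : n + k = N) (x : E) :
    G.tailPayoff π σ γ n k x ≤ ENNReal.ofReal (G.value n (x, G.rescale k γ)) := by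
  induction n generalizing k x with
  | zero => simp [tailPayoff, value]
  | succ n ih =>
    refine le_trans ?_ (ENNReal.ofReal_le_ofReal (h n k hnk x))
    rw [← G.lintegral_decisionKernel_value hcomp hcorr hr hQ, tailPayoff]
    gcongr with p x'
    exact ih (k + 1) (by omega) x'

/-- If player 1's rules secure the value of each one-stage game, then they do so for the rest of
the game. -/
lemma value_le_tailPayoff {π : G.PolicyA} {σ : G.PolicyB} {γ : G.Risk} {N : ℕ}
    (h : ∀ n k, n + 1 + k = N → ∀ x, G.value (n + 1) (x, G.rescale k γ) ≤
      G.L (G.value n) x (G.rescale k γ) ((π k).1 x) ((σ k).1 x)) (n k : ℕ) (hnk : n + k = N)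
    (x : E) : ENNReal.ofReal (G.value n (x, G.rescale k γ)) ≤ G.tailPayoff π σ γ n k x := by
  induction n generalizing k x with
  | zero => simp [tailPayoff, value]
  | succ n ih =>
    refine (ENNReal.ofReal_le_ofReal (h n k hnk x)).trans ?_
    rw [← G.lintegral_decisionKernel_value hcomp hcorr hr hQ, tailPayoff]
    gcongr with p x'
    exact ih (k + 1) (by omega) x'

/-! ### Saddle selectors give a saddle point of the multistage game -/

lemma payoff_selectorPolicyB_le_value {N : ℕ} {μ : ℕ → G.SelectorA} {ν : ℕ → G.SelectorB}
    (h : ∀ n, n + 1 ≤ N → G.IsSaddleSelector (G.value n) (μ (n + 1)) (ν (n + 1)))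
    (π : G.PolicyA) (x : E) (γ : G.Risk) :
    G.payoff N π (G.selectorPolicyB N ν γ) x γ ≤ G.value N (x, γ) := by
  rw [← ENNReal.ofReal_le_ofReal_iff (G.value_nonneg N _), ofReal_payoff]
  have := G.tailPayoff_le_value hcomp hcorr hr hQ (π := π) (σ := G.selectorPolicyB N ν γ) (γ := γ)
    (N := N) (fun n k hnk x => ?_) N 0 (add_zero N) x
  · rwa [rescale_zero] at this
  · have hN : N - k = n + 1 := by omega
    have hs := h n (by omega)
    rw [G.value_succ_eq_of_isSaddleSelector hcomp hcorr hr hQ hs]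
    change G.L _ x _ _ ((ν (N - k)).1 (x, G.rescale k γ)) ≤ _
    rw [hN]
    exact (hs (x, G.rescale k γ)).1 ⟨(π k).1 x, (π k).2.2 x⟩

lemma value_le_payoff_selectorPolicyA {N : ℕ} {μ : ℕ → G.SelectorA} {ν : ℕ → G.SelectorB}
    (h : ∀ n, n + 1 ≤ N → G.IsSaddleSelector (G.value n) (μ (n + 1)) (ν (n + 1)))
    (σ : G.PolicyB) (x : E) (γ : G.Risk) :
    G.value N (x, γ) ≤ G.payoff N (G.selectorPolicyA N μ γ) σ x γ := by
  rw [← ENNReal.ofReal_le_ofReal_iff (G.payoff_nonneg _ _ N _ _), ofReal_payoff]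
  have := G.value_le_tailPayoff hcomp hcorr hr hQ (π := G.selectorPolicyA N μ γ) (σ := σ) (γ := γ)
    (N := N) (fun n k hnk x => ?_) N 0 (add_zero N) x
  · rwa [rescale_zero] at this
  · have hN : N - k = n + 1 := by omega
    have hs := h n (by omega)
    rw [G.value_succ_eq_of_isSaddleSelector hcomp hcorr hr hQ hs]
    change _ ≤ G.L _ x _ ((μ (N - k)).1 (x, G.rescale k γ)) _
    rw [hN]
    exact (hs (x, G.rescale k γ)).2 ⟨(σ k).1 x, (σ k).2.2 x⟩

/-- The policies built from saddle selectors form a saddle point with payoff `value N`, so the upper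
and the lower value coincide with it. -/
theorem upperValue_eq_value_and_lowerValue_eq_value (N : ℕ) (z : E × G.Risk) :
    G.upperValue N z = G.value N z ∧ G.lowerValue N z = G.value N z := by
  obtain ⟨x, γ⟩ := z
  choose μ ν h using G.exists_isSaddleSelector_value hcomp hcorr hr hQ
  have hB := fun π => G.payoff_selectorPolicyB_le_value hcomp hcorr hr hQ (N := N)
    (μ := fun n => μ (n - 1)) (ν := fun n => ν (n - 1)) (fun n _ => h n) π x γ
  have hA := fun σ => G.value_le_payoff_selectorPolicyA hcomp hcorr hr hQ (N := N)
    (μ := fun n => μ (n - 1)) (ν := fun n => ν (n - 1)) (fun n _ => h n) σ x γ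
  have hs : IsSaddlePoint (fun π σ => G.payoff N π σ x γ)
      (G.selectorPolicyA N (fun n => μ (n - 1)) γ) (G.selectorPolicyB N (fun n => ν (n - 1)) γ) :=
    ⟨fun π => (hB π).trans (hA _), fun σ => (hB _).trans (hA σ)⟩
  have hb : ∀ π σ, |G.payoff N π σ x γ| ≤ _ := fun π σ => G.abs_payoff_le π σ N x γ
  have hval := le_antisymm (hB _) (hA _)
  exact ⟨(hs.iInf_iSup_eq hb).trans hval, (hs.iSup_iInf_eq hb).trans hval⟩

end Regularity

end Game

end RiskGame

end

theorem mainTheorem1 {E A B : Type*}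
    [TopologicalSpace E] [TopologicalSpace.MetrizableSpace E] [SecondCountableTopology E]
    [MeasurableSpace E] [BorelSpace E] [StandardBorelSpace E]
    [TopologicalSpace A] [TopologicalSpace.MetrizableSpace A] [SecondCountableTopology A]
    [MeasurableSpace A] [BorelSpace A] [StandardBorelSpace A]
    [TopologicalSpace B] [TopologicalSpace.MetrizableSpace B] [SecondCountableTopology B]
    [MeasurableSpace B] [BorelSpace B] [StandardBorelSpace B]
    (G : RiskGame.Game E A B)
    (hA1 : ∀ x, IsCompact (G.admA x) ∧ IsCompact (G.admB x))
    (hA2 : RiskGame.ContinuousCorrespondence G.admA ∧ RiskGame.ContinuousCorrespondence G.admB)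
    (hA3 : Continuous G.r)
    (hA4 : ∀ v : BoundedContinuousFunction E ℝ, Continuous fun p => ∫ x', v x' ∂(G.Q p))
    (N : ℕ) :
    -- the initial function of the recursion
    (∀ z, G.upperValue 0 z = 1) ∧
    -- regularity and the Shapley equation
    (∀ n, 1 ≤ n → n ≤ N →
      Continuous (G.upperValue n) ∧ (∃ C : ℝ, ∀ z, |G.upperValue n z| ≤ C) ∧
      (∀ z, G.upperValue n z = G.T (G.upperValue (n - 1)) z) ∧
      (∀ (x : E) (γ : G.Risk), G.T (G.upperValue (n - 1)) (x, γ) =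
        ⨅ ν : RiskGame.probOn (G.admB x), ⨆ μ : RiskGame.probOn (G.admA x),
          G.L (G.upperValue (n - 1)) x γ μ ν) ∧
      (∀ (x : E) (γ : G.Risk), G.T (G.upperValue (n - 1)) (x, γ) =
        ⨆ μ : RiskGame.probOn (G.admA x), ⨅ ν : RiskGame.probOn (G.admB x),
          G.L (G.upperValue (n - 1)) x γ μ ν)) ∧
    -- measurable saddle-point selectors
    (∀ n, 1 ≤ n → n ≤ N → ∃ (μ : G.SelectorA) (ν : G.SelectorB),
      G.IsSaddleSelector (G.upperValue (n - 1)) μ ν) ∧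
    -- the game has a value
    (∀ z, G.upperValue N z = G.lowerValue N z) ∧
    -- all such selectors yield optimal policies
    (∀ (μ : ℕ → G.SelectorA) (ν : ℕ → G.SelectorB),
      (∀ n, 1 ≤ n → n ≤ N → G.IsSaddleSelector (G.upperValue (n - 1)) (μ n) (ν n)) →
      ∀ γ : G.Risk, G.IsOptimalA N γ (G.selectorPolicyA N μ γ) ∧
        G.IsOptimalB N γ (G.selectorPolicyB N ν γ)) := by
  have hup : ∀ n, G.upperValue n = G.value n := fun n => funext fun z =>
    (G.upperValue_eq_value_and_lowerValue_eq_value hA1 hA2 hA3 hA4 n z).1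
  have hlow : ∀ n, G.lowerValue n = G.value n := fun n => funext fun z =>
    (G.upperValue_eq_value_and_lowerValue_eq_value hA1 hA2 hA3 hA4 n z).2
  simp only [RiskGame.Game.IsOptimalA, RiskGame.Game.IsOptimalB, hup, hlow]
  refine ⟨fun z => rfl, fun n hn _ => ?_, fun n _ _ =>
    G.exists_isSaddleSelector_value hA1 hA2 hA3 hA4 (n - 1), fun _ => trivial, fun μ ν h γ => ?_⟩
  · obtain ⟨m, rfl⟩ := Nat.exists_eq_add_of_le' hn
    obtain ⟨w, hw⟩ := G.exists_boundedContinuous_eq_value hA1 hA2 hA3 hA4 (m + 1)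
    rw [Nat.add_sub_cancel]
    refine ⟨hw ▸ w.continuous, ⟨‖w‖, fun z => hw ▸ w.norm_coe_le_norm z⟩,
      fun z => (G.T_eq_iInf_iSup _ z).symm, fun x γ => G.T_eq_iInf_iSup _ (x, γ), fun x γ => ?_⟩
    rw [G.T_eq_iInf_iSup]
    exact G.value_succ_eq_iSup_iInf hA1 hA2 hA3 hA4 m (x, γ)
  · have h' : ∀ n, n + 1 ≤ N → G.IsSaddleSelector (G.value n) (μ (n + 1)) (ν (n + 1)) :=
      fun n hn => h (n + 1) (Nat.le_add_left 1 n) hn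
    exact ⟨fun x σ => G.value_le_payoff_selectorPolicyA hA1 hA2 hA3 hA4 h' σ x γ,
      fun x π => G.payoff_selectorPolicyB_le_value hA1 hA2 hA3 hA4 h' π x γ⟩
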